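/- Let $\varepsilon\in(0,2)$. Let $W_2^1(-\pi,\pi)$ be the space of (classes of) absolutely continuous functions $h:[-\pi,\pi]\to\mathbb C$ with $h'\in L^2(-\pi,\pi)$, and let $X_2$ be the space of all $h\in W_2^1(-\pi,\pi)$ such that $h(-\pi)=h(\pi)$ and $(\sin\theta)\,h'\in W_2^1(-\pi,\pi)$. Let $L$ be the operator in the complex Hilbert space $L^2(-\pi,\pi)$ with domain $X_2$ given by $$Lh=\varepsilon\,\frac{d}{d\theta}\Bigl(\sin\theta\,\frac{dh}{d\theta}\Bigr)+\frac{dh}{d\theta}.$$ Let $L^2_p(-\pi,\pi)$ be the closed subspace of all $f\in L^2(-\pi,\pi)$ with $\int_{-\pi}^{\pi}f\,d\theta=0$ (it contains the range of $L$), and let $\widetilde L$ be the restriction of $L$ to $X_2\cap L^2_p(-\pi,\pi)$, considered as an operator in the Hilbert space $L^2_p(-\pi,\pi)$. For $0<p<\infty$ let $\mathfrak S_p$ be the class of compact operators $A$ on a Hilbert space with $\sum_j s_j(A)^p<\infty$, where $s_1(A)\ge s_2(A)\ge\dots$ are the eigenvalues of $(A^*A)^{1/2}$ counted with multiplicities;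 operators in $\mathfrak S_1$ are called nuclear. Then $\widetilde L$ is injective with range $L^2_p(-\pi,\pi)$, its inverse $\widetilde L^{-1}$ is a bounded operator on $L^2_p(-\pi,\pi)$, and $\widetilde L^{-1}$ is nuclear, i.e. $\widetilde L^{-1}\in\mathfrak S_1$. More precisely: (i) if $\varepsilon\in(0,1]$, then $\widetilde L^{-1}\in\mathfrak S_p$ for every $p>2/3$; (ii) if $\varepsilon\in(1,2)$, then $\widetilde L^{-1}\in\mathfrak S_p$ for every $p>2\varepsilon/(\varepsilon+2)$. -/

import Mathlib

open MeasureTheory Set Filter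
open scoped Real

noncomputable section

/-! ### Singular numbers and the classes `𝔖_p` -/

section Schatten

variable {H : Type*} [NormedAddCommGroup H] [InnerProductSpace ℂ H] [CompleteSpace H]

/-- The `j`-th singular number (`j = 0, 1, 2, …`) of a compact operator `A`: the `(j+1)`-st largest
eigenvalue of `|A| = (A* A)^{1/2}`, counted with multiplicity, i.e. the largest `μ > 0` such that
the eigenspaces of `|A|` for eigenvalues `≥ μ` together have dimension at least `j + 1`
(and `0` if there is no such `μ`). -/
def singularNumber (A : H →L[ℂ] H) (j : ℕ) : ℝ :=
  sSup {μ : ℝ | 0 < μ ∧ ((j + 1 : ℕ) : Cardinal) ≤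
    Module.rank ℂ ↥(⨆ ν ∈ Ici μ,
      Module.End.eigenspace ((CFC.abs A : H →L[ℂ] H) : Module.End ℂ H) ((ν : ℝ) : ℂ))}

/-- The class `𝔖_p`, `0 < p < ∞`: the compact operators whose singular numbers are `p`-summable. -/
structure MemSchatten (p : ℝ) (A : H →L[ℂ] H) : Prop where
  compact : IsCompactOperator A
  summable : Summable fun j : ℕ => singularNumber A j ^ p

/-- Nuclear operators: the class `𝔖_1`. -/
def IsNuclear (A : H →L[ℂ] H) : Prop := MemSchatten 1 A

end Schatten

/-! ### The spaces -/

/-- Lebesgue measure on `(-π, π)`. -/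
abbrev circVol : Measure ℝ := volume.restrict (Ioo (-π) π)

/-- The complex Hilbert space `L²(-π, π)`. -/
abbrev L2Circ : Type := Lp ℂ 2 circVol

/-- `u ∈ W_2^1(-π, π)` and `g = u'`: the class `u` has an absolutely continuous representative
on `[-π, π]` whose derivative is `g ∈ L²` almost everywhere. -/
def HasL2Deriv (u g : L2Circ) : Prop :=
  ∃ v : ℝ → ℂ, AbsolutelyContinuousOnInterval v (-π) π ∧ u =ᵐ[circVol] v ∧
    ∀ᵐ θ ∂circVol, HasDerivAt v (g θ) θ

/-- `u ∈ W_{2p}^1(-π, π)` and `g = u'`: as `HasL2Deriv`, with `u(-π) = u(π)`. -/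
def HasPeriodicL2Deriv (u g : L2Circ) : Prop :=
  ∃ v : ℝ → ℂ, AbsolutelyContinuousOnInterval v (-π) π ∧ u =ᵐ[circVol] v ∧
    (∀ᵐ θ ∂circVol, HasDerivAt v (g θ) θ) ∧ v (-π) = v π

theorem HasPeriodicL2Deriv.hasL2Deriv {u g : L2Circ} (h : HasPeriodicL2Deriv u g) :
    HasL2Deriv u g := by
  obtain ⟨v, h1, h2, h3, -⟩ := h
  exact ⟨v, h1, h2, h3⟩

theorem HasL2Deriv.add {u g u' g' : L2Circ} (h : HasL2Deriv u g) (h' : HasL2Deriv u' g') :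
    HasL2Deriv (u + u') (g + g') := by
  obtain ⟨v, h1, h2, h3⟩ := h
  obtain ⟨v', h1', h2', h3'⟩ := h'
  refine ⟨v + v', h1.add h1', ?_, ?_⟩
  · exact (Lp.coeFn_add u u').trans (h2.add h2')
  · filter_upwards [h3, h3', Lp.coeFn_add g g'] with θ a b c
    rw [c]
    exact a.add b

theorem HasPeriodicL2Deriv.add {u g u' g' : L2Circ} (h : HasPeriodicL2Deriv u g)
    (h' : HasPeriodicL2Deriv u' g') : HasPeriodicL2Deriv (u + u') (g + g') := by
  obtain ⟨v, h1, h2, h3, h4⟩ := h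
  obtain ⟨v', h1', h2', h3', h4'⟩ := h'
  refine ⟨v + v', h1.add h1', ?_, ?_, ?_⟩
  · exact (Lp.coeFn_add u u').trans (h2.add h2')
  · filter_upwards [h3, h3', Lp.coeFn_add g g'] with θ a b c
    rw [c]
    exact a.add b
  · simp [h4, h4']

theorem HasL2Deriv.smul {u g : L2Circ} (c : ℂ) (h : HasL2Deriv u g) :
    HasL2Deriv (c • u) (c • g) := by
  obtain ⟨v, h1, h2, h3⟩ := h
  refine ⟨fun θ => c • v θ, h1.const_smul c, ?_, ?_⟩
  · exact (Lp.coeFn_smul c u).trans (h2.const_smul c)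
  · filter_upwards [h3, Lp.coeFn_smul c g] with θ a b
    rw [b]
    exact a.const_smul c

theorem HasPeriodicL2Deriv.smul {u g : L2Circ} (c : ℂ) (h : HasPeriodicL2Deriv u g) :
    HasPeriodicL2Deriv (c • u) (c • g) := by
  obtain ⟨v, h1, h2, h3, h4⟩ := h
  refine ⟨fun θ => c • v θ, h1.const_smul c, ?_, ?_, by simp [h4]⟩
  · exact (Lp.coeFn_smul c u).trans (h2.const_smul c)
  · filter_upwards [h3, Lp.coeFn_smul c g] with θ a b
    rw [b]
    exact a.const_smul c

theorem hasPeriodicL2Deriv_zero : HasPeriodicL2Deriv 0 0 := by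
  refine ⟨fun _ => 0, ?_, Lp.coeFn_zero _ _ _, ?_, rfl⟩
  · simp only [AbsolutelyContinuousOnInterval, dist_self, Finset.sum_const_zero]
    exact tendsto_const_nhds
  · filter_upwards [Lp.coeFn_zero ℂ 2 circVol] with θ a
    rw [a]
    exact hasDerivAt_const _ _

/-- The derivative of a class in `W_2^1` is unique. -/
theorem HasL2Deriv.eq_zero {g : L2Circ} (h : HasL2Deriv 0 g) : g = 0 := by
  obtain ⟨v, h1, h2, h3⟩ := h
  have hpi : -π < π := by linarith [Real.pi_pos]
  have hc : ContinuousOn v (Ioo (-π) π) :=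
    h1.continuousOn.mono (by rw [uIcc_of_le hpi.le]; exact Ioo_subset_Icc_self)
  have hz : EqOn v (fun _ => (0 : ℂ)) (Ioo (-π) π) := by
    refine Measure.eqOn_of_ae_eq (μ := volume) ?_ hc continuousOn_const ?_
    · filter_upwards [h2, Lp.coeFn_zero ℂ 2 circVol] with θ a b
      rw [← a, b]
      rfl
    · rw [interior_Ioo]
      exact subset_closure
  refine Lp.ext ?_
  filter_upwards [h3, Lp.coeFn_zero ℂ 2 circVol, ae_restrict_mem measurableSet_Ioo] with θ a b c
  rw [b]
  have : v =ᶠ[nhds θ] fun _ => 0 := by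
    filter_upwards [isOpen_Ioo.mem_nhds c] with x hx using hz hx
  exact a.unique ((hasDerivAt_const θ (0 : ℂ)).congr_of_eventuallyEq this)

/-! ### The operator `L` -/

/-- The graph of `L`: the pairs `(h, f)` with `h ∈ X₂`, i.e. `h ∈ W_{2p}^1(-π, π)` and
`(sin θ) h' ∈ W_2^1(-π, π)`, and `f = ε ((sin θ) h')' + h'`. -/
def graphL (ε : ℝ) : Submodule ℂ (L2Circ × L2Circ) where
  carrier := {x | ∃ g w k : L2Circ, HasPeriodicL2Deriv x.1 g ∧
    (w =ᵐ[circVol] fun θ => (Real.sin θ : ℂ) * g θ) ∧ HasL2Deriv w k ∧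
    x.2 = (ε : ℂ) • k + g}
  zero_mem' := by
    refine ⟨0, 0, 0, hasPeriodicL2Deriv_zero, ?_, hasPeriodicL2Deriv_zero.hasL2Deriv, by simp⟩
    filter_upwards [Lp.coeFn_zero ℂ 2 circVol] with θ a
    rw [a]
    simp
  add_mem' := by
    rintro x y ⟨g, w, k, h1, h2, h3, h4⟩ ⟨g', w', k', h1', h2', h3', h4'⟩
    refine ⟨g + g', w + w', k + k', h1.add h1', ?_, h3.add h3', ?_⟩
    · filter_upwards [h2, h2', Lp.coeFn_add g g', Lp.coeFn_add w w'] with θ a b c d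
      rw [d, c, Pi.add_apply, Pi.add_apply, a, b, mul_add]
    · rw [Prod.snd_add, h4, h4', smul_add]
      abel
  smul_mem' := by
    rintro c x ⟨g, w, k, h1, h2, h3, h4⟩
    refine ⟨c • g, c • w, c • k, h1.smul c, ?_, h3.smul c, ?_⟩
    · filter_upwards [h2, Lp.coeFn_smul c g, Lp.coeFn_smul c w] with θ a b d
      rw [d, b, Pi.smul_apply, Pi.smul_apply, a, smul_eq_mul, smul_eq_mul, mul_left_comm]
    · rw [Prod.smul_snd, h4, smul_add, smul_comm]

theorem graphL_single_valued (ε : ℝ) :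
    ∀ x : L2Circ × L2Circ, x ∈ graphL ε → x.1 = 0 → x.2 = 0 := by
  rintro ⟨h, f⟩ ⟨g, w, k, h1, h2, h3, h4⟩ h0
  simp only at h0 h1 h4 ⊢
  subst h0
  have hg : g = 0 := h1.hasL2Deriv.eq_zero
  have hw : w = 0 := by
    refine Lp.ext ?_
    filter_upwards [h2, Lp.coeFn_zero ℂ 2 circVol] with θ a b
    rw [a, hg, b]
    simp
  subst hw
  rw [h4, hg, h3.eq_zero]
  simp

/-- The operator `L h = ε ((sin θ) h')' + h'` in `L²(-π, π)` with domain `X₂`. -/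
def opL (ε : ℝ) : L2Circ →ₗ.[ℂ] L2Circ := (graphL ε).toLinearPMap

theorem opL_graph (ε : ℝ) : (opL ε).graph = graphL ε :=
  Submodule.toLinearPMap_graph_eq _ (graphL_single_valued ε)

/-! ### The subspace of functions with zero mean -/

theorem integrable_L2Circ (f : L2Circ) : Integrable f circVol :=
  (Lp.memLp f).integrable (by norm_num)

/-- The subspace `L²_p(-π, π)` of the functions `f` with `∫ f = 0`. -/
def zeroMean : Submodule ℂ L2Circ where
  carrier := {f | ∫ θ, f θ ∂circVol = 0}
  zero_mem' := by
    rw [mem_ofPred_eq, integral_congr_ae (Lp.coeFn_zero ℂ 2 circVol)]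
    simp
  add_mem' := by
    intro f g hf hg
    rw [mem_ofPred_eq] at hf hg ⊢
    rw [integral_congr_ae (Lp.coeFn_add f g)]
    simp only [Pi.add_apply]
    rw [integral_add (integrable_L2Circ f) (integrable_L2Circ g), hf, hg, add_zero]
  smul_mem' := by
    intro c f hf
    rw [mem_ofPred_eq] at hf ⊢
    rw [integral_congr_ae (Lp.coeFn_smul c f)]
    simp only [Pi.smul_apply]
    rw [integral_smul, hf, smul_zero]

theorem zeroMean_isClosed : IsClosed (zeroMean : Set L2Circ) := by
  have h : (zeroMean : Set L2Circ) = {f : L2Circ | inner ℂ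
      (indicatorConstLp 2 (μ := circVol) MeasurableSet.univ (measure_ne_top _ _) (1 : ℂ)) f = 0} := by
    ext f
    rw [mem_ofPred_eq, L2.inner_indicatorConstLp_one, setIntegral_univ]
    rfl
  rw [h]
  exact isClosed_eq (by fun_prop) continuous_const

instance : CompleteSpace zeroMean := zeroMean_isClosed.completeSpace_coe

/-! ### The range of `L` consists of functions with zero mean -/

theorem integral_of_ac_real {w : ℝ → ℝ} {k : ℝ → ℝ}
    (hw : AbsolutelyContinuousOnInterval w (-π) π)
    (hk : ∀ᵐ θ ∂circVol, HasDerivAt w (k θ) θ) :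
    ∫ θ, k θ ∂circVol = w π - w (-π) := by
  have hpi : -π ≤ π := by linarith [Real.pi_pos]
  rw [← hw.integral_deriv_eq_sub, intervalIntegral.integral_of_le hpi,
    integral_Ioc_eq_integral_Ioo]
  refine integral_congr_ae ?_
  filter_upwards [hk] with θ h using h.deriv.symm

theorem integral_of_ac {w : ℝ → ℂ} {k : ℝ → ℂ}
    (hw : AbsolutelyContinuousOnInterval w (-π) π) (hi : Integrable k circVol)
    (hk : ∀ᵐ θ ∂circVol, HasDerivAt w (k θ) θ) :
    ∫ θ, k θ ∂circVol = w π - w (-π) := by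
  have hre : AbsolutelyContinuousOnInterval (fun θ => (w θ).re) (-π) π := by
    refine squeeze_zero (fun t => Finset.sum_nonneg fun i _ => dist_nonneg) (fun t => ?_) hw
    refine Finset.sum_le_sum fun i _ => ?_
    rw [Real.dist_eq, dist_eq_norm, ← Complex.sub_re]
    exact Complex.abs_re_le_norm _
  have him : AbsolutelyContinuousOnInterval (fun θ => (w θ).im) (-π) π := by
    refine squeeze_zero (fun t => Finset.sum_nonneg fun i _ => dist_nonneg) (fun t => ?_) hw
    refine Finset.sum_le_sum fun i _ => ?_
    rw [Real.dist_eq, dist_eq_norm, ← Complex.sub_im]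
    exact Complex.abs_im_le_norm _
  have h1 := integral_of_ac_real (k := fun θ => (k θ).re) hre (by
    filter_upwards [hk] with θ h
    exact (Complex.reCLM.hasFDerivAt.comp_hasDerivAt θ h))
  have h2 := integral_of_ac_real (k := fun θ => (k θ).im) him (by
    filter_upwards [hk] with θ h
    exact (Complex.imCLM.hasFDerivAt.comp_hasDerivAt θ h))
  apply Complex.ext
  · rw [Complex.sub_re, ← h1]
    exact (integral_re hi).symm
  · rw [Complex.sub_im, ← h2]
    exact (integral_im hi).symm

/-- If `w` is absolutely continuous and `w / sin` is integrable, then `w` vanishes at the zeros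
of `sin` in `[-π, π]`. -/
theorem eq_zero_of_sin_mul {w g : ℝ → ℂ} (hw : AbsolutelyContinuousOnInterval w (-π) π)
    (hg : Integrable g circVol) (hwg : ∀ᵐ θ ∂circVol, w θ = (Real.sin θ : ℂ) * g θ)
    {c : ℝ} (hc : c ∈ Icc (-π) π) (hs : Real.sin c = 0) : w c = 0 := by
  have hpi : -π < π := by linarith [Real.pi_pos]
  by_contra hne
  have hcont := hw.continuousOn
  rw [uIcc_of_le hpi.le] at hcont
  have hpos : 0 < ‖w c‖ / 2 := by positivity
  obtain ⟨δ, hδ, hball⟩ := Metric.continuousOn_iff.1 hcont c hc _ hpos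
  have hint : IntegrableOn (fun θ : ℝ => (θ - c)⁻¹) (Ioo (-π) π) := by
    refine Integrable.mono' (g := fun θ => 2 / ‖w c‖ * ‖g θ‖ + δ⁻¹)
      ((hg.norm.const_mul _).add (integrable_const _)) (by fun_prop) ?_
    filter_upwards [hwg, ae_restrict_mem measurableSet_Ioo] with θ h1 h2
    rw [norm_inv, Real.norm_eq_abs]
    have h3 : 0 ≤ 2 / ‖w c‖ * ‖g θ‖ := by positivity
    have h4 : 0 < δ⁻¹ := by positivity
    rcases lt_or_ge |θ - c| δ with h | h
    · have h5 := hball θ ⟨h2.1.le, h2.2.le⟩ (by rwa [Real.dist_eq])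
      have h6 : ‖w c‖ / 2 ≤ ‖w θ‖ := by
        have := norm_sub_norm_le (w c) (w θ)
        rw [dist_eq_norm, norm_sub_rev] at h5
        linarith
      have h7 : |Real.sin θ| ≤ |θ - c| := by
        have := Real.abs_sin_sub_sin_le θ c
        rwa [hs, sub_zero] at this
      have h8 : ‖w θ‖ ≤ |θ - c| * ‖g θ‖ := by
        rw [h1, norm_mul, Complex.norm_real, Real.norm_eq_abs]
        gcongr
      have h9 : 0 < |θ - c| := by
        by_contra h0
        have : |θ - c| = 0 := le_antisymm (not_lt.1 h0) (abs_nonneg _)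
        rw [this, zero_mul] at h8
        linarith
      have h10 : |θ - c|⁻¹ ≤ 2 / ‖w c‖ * ‖g θ‖ := by
        rw [inv_le_iff_one_le_mul₀ h9]
        have : 0 < ‖w c‖ := by linarith
        rw [div_mul_eq_mul_div, div_mul_eq_mul_div, le_div_iff₀ this]
        linarith
      linarith
    · have : |θ - c|⁻¹ ≤ δ⁻¹ := by gcongr
      linarith
  have h : IntervalIntegrable (fun θ : ℝ => (θ - c)⁻¹) volume (-π) π := by
    rw [intervalIntegrable_iff_integrableOn_Ioo_of_le hpi.le]
    exact hint
  rcases intervalIntegrable_sub_inv_iff.1 h with h | h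
  · linarith
  · exact h (by rwa [uIcc_of_le hpi.le])

theorem snd_mem_zeroMean {ε : ℝ} {x : L2Circ × L2Circ} (hx : x ∈ graphL ε) : x.2 ∈ zeroMean := by
  obtain ⟨g, w, k, ⟨v, h1, -, h3, h4⟩, h5, ⟨u, h6, h7, h8⟩, h9⟩ := hx
  have hpi := Real.pi_pos
  have hu : ∀ᵐ θ ∂circVol, u θ = (Real.sin θ : ℂ) * g θ := by
    filter_upwards [h5, h7] with θ a b
    rw [← b, a]
  have hg : g ∈ zeroMean := by
    change ∫ θ, g θ ∂circVol = 0
    rw [integral_of_ac h1 (integrable_L2Circ g) h3, h4, sub_self]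
  have hk : k ∈ zeroMean := by
    change ∫ θ, k θ ∂circVol = 0
    rw [integral_of_ac h6 (integrable_L2Circ k) h8,
      eq_zero_of_sin_mul h6 (integrable_L2Circ g) hu (c := π) ⟨by linarith, le_rfl⟩ Real.sin_pi,
      eq_zero_of_sin_mul h6 (integrable_L2Circ g) hu (c := -π) ⟨le_rfl, by linarith⟩ (by simp),
      sub_self]
  rw [h9]
  exact zeroMean.add_mem (zeroMean.smul_mem _ hk) hg

theorem opL_mem_zeroMean (ε : ℝ) (h : (opL ε).domain) : opL ε h ∈ zeroMean :=
  snd_mem_zeroMean (x := ((h : L2Circ), opL ε h)) (ε := ε) (by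
    rw [← opL_graph]
    exact (opL ε).mem_graph h)

/-- The operator `L̃`: the restriction of `L` to `L²_p(-π, π)`, with domain
`Dom(L) ∩ L²_p(-π, π)`, as an operator in the Hilbert space `L²_p(-π, π)`. -/
def opLtilde (ε : ℝ) : zeroMean →ₗ.[ℂ] zeroMean where
  domain := (opL ε).domain.comap zeroMean.subtype
  toFun :=
    { toFun := fun h => ⟨opL ε ⟨((h : zeroMean) : L2Circ), h.2⟩, opL_mem_zeroMean ε _⟩
      map_add' := fun x y => Subtype.ext
        ((opL ε).map_add ⟨((x : zeroMean) : L2Circ), x.2⟩ ⟨((y : zeroMean) : L2Circ), y.2⟩)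
      map_smul' := fun c x => Subtype.ext
        ((opL ε).map_smul c ⟨((x : zeroMean) : L2Circ), x.2⟩) }

/-- The bounded operator `T` on the whole space is the inverse of the (unbounded) operator `A`. -/
def IsBoundedInverse {H : Type*} [NormedAddCommGroup H] [InnerProductSpace ℂ H]
    (A : H →ₗ.[ℂ] H) (T : H →L[ℂ] H) : Prop :=
  A.toFun.ker = ⊥ ∧ A.inverse = (T : H →ₗ[ℂ] H).toPMap ⊤

end

/-! Write g = h' and β = 1/ε. Then Lh = f becomes ((sin θ) g)' + β g = β f. Let t = |tan (θ/2)|,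
whose logarithmic derivative is 1/sin θ. The integrating factor t^β gives g(θ) = β t(θ)^(-β) / sin θ
· ∫_0^θ t^β f. Nonzero homogeneous solutions (sin θ) g = C t^(-β) blow up at 0, so continuity of
(sin θ) g selects this g and makes `L̃` injective (`eq_zero_of_mem_graphL`). A weighted Hardy
inequality, valid for β > 1/2, i.e. ε < 2, puts g in L²
(`lintegral_enorm_integral_solKernel_sq_lt_top`). Since (sin θ) g vanishes at ±π, zero mean passes
from f to g; hence the primitive h of g is periodic, and its additive constant is fixed by its mean
(`mem_graphL_invLtilde`).

For the singular numbers, the map f ↦ ∫_{-π}^θ g is factored as V K. Here K maps f to |sin θ|^(1/4)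
g and is Hilbert–Schmidt, so it lies within O(n^(-1/2)) of rank n (`exists_hasRankApprox_kernelOp`).
V integrates against the square integrable weight |sin|^(-1/4); freezing it on a partition into n +
1 cells shows that it lies within O(1/n) of rank n (`exists_hasRankApprox_volterraOp`). Errors
multiply while ranks add (`HasRankApprox.comp`), so V K is within O(n^(-3/2)) of rank 2n and s_j =
O(j^(-3/2)).

This gives every p > 2/3 for all ε in (0,2). Both (i) and (ii) follow, because 2ε/(ε+2) > 2/3 when ε
> 1. -/

/-! ### Approximation by operators of finite rank -/

section RankApprox

variable {E F G : Type} [NormedAddCommGroup E] [InnerProductSpace ℂ E]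
  [NormedAddCommGroup F] [InnerProductSpace ℂ F] [NormedAddCommGroup G] [InnerProductSpace ℂ G]

/-- `A` is within `c`, in operator norm, of an operator of rank at most `n`. -/
def HasRankApprox (A : E →L[ℂ] F) (n : ℕ) (c : ℝ) : Prop :=
  ∃ R : E →L[ℂ] F, LinearMap.rank (R : E →ₗ[ℂ] F) ≤ n ∧ ‖A - R‖ ≤ c

theorem HasRankApprox.nonneg {A : E →L[ℂ] F} {n : ℕ} {c : ℝ} (h : HasRankApprox A n c) :
    0 ≤ c := by
  obtain ⟨R, -, h2⟩ := h
  exact (norm_nonneg _).trans h2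

theorem HasRankApprox.mono {A : E →L[ℂ] F} {n m : ℕ} {c d : ℝ} (h : HasRankApprox A n c)
    (hnm : n ≤ m) (hcd : c ≤ d) : HasRankApprox A m d := by
  obtain ⟨R, h1, h2⟩ := h
  exact ⟨R, h1.trans (by exact_mod_cast hnm), h2.trans hcd⟩

/-- (A - R)(B - S) = AB - (R(B - S) + AS), and the subtracted operator has rank at most n + m. The
errors therefore multiply, which is how the rates 1 and 1/2 add up to 3/2. -/
theorem HasRankApprox.comp {A : F →L[ℂ] G} {B : E →L[ℂ] F} {n m : ℕ} {a b : ℝ}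
    (hA : HasRankApprox A n a) (hB : HasRankApprox B m b) :
    HasRankApprox (A ∘L B) (n + m) (a * b) := by
  have ha := hA.nonneg
  obtain ⟨R, h1, h2⟩ := hA
  obtain ⟨S, h3, h4⟩ := hB
  refine ⟨R ∘L (B - S) + A ∘L S, ?_, ?_⟩
  · push_cast
    refine (LinearMap.rank_add_le _ _).trans (add_le_add ?_ ?_)
    · exact (LinearMap.rank_comp_le_left _ _).trans h1
    · exact (LinearMap.rank_comp_le_right _ _).trans h3
  · have : A ∘L B - (R ∘L (B - S) + A ∘L S) = (A - R) ∘L (B - S) := by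
      ext x
      simp only [sub_apply, ContinuousLinearMap.comp_apply,
        add_apply, map_sub]
      abel
    rw [this]
    exact (ContinuousLinearMap.opNorm_comp_le _ _).trans (by gcongr)

theorem HasRankApprox.comp_left {B : E →L[ℂ] F} {n : ℕ} {b : ℝ} (hB : HasRankApprox B n b)
    (A : F →L[ℂ] G) : HasRankApprox (A ∘L B) n (‖A‖ * b) := by
  have hA : HasRankApprox A 0 ‖A‖ := ⟨0, by simp [LinearMap.rank_zero], by simp⟩
  simpa using hA.comp hB

theorem HasRankApprox.comp_right {A : F →L[ℂ] G} {n : ℕ} {a : ℝ} (hA : HasRankApprox A n a)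
    (B : E →L[ℂ] F) : HasRankApprox (A ∘L B) n (a * ‖B‖) := by
  have hB : HasRankApprox B 0 ‖B‖ := ⟨0, by simp [LinearMap.rank_zero], by simp⟩
  simpa using hA.comp hB

/-- An operator of finite rank is compact. -/
theorem isCompactOperator_of_rank_le {R : E →L[ℂ] F} {n : ℕ}
    (h : LinearMap.rank (R : E →ₗ[ℂ] F) ≤ n) : IsCompactOperator R := by
  have hfin : FiniteDimensional ℂ (LinearMap.range (R : E →ₗ[ℂ] F)) :=
    Module.rank_lt_aleph0_iff.1 (h.trans_lt (Cardinal.natCast_lt_aleph0))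
  have hprop : ProperSpace (LinearMap.range (R : E →ₗ[ℂ] F)) := FiniteDimensional.proper ℂ _
  let S : E →L[ℂ] LinearMap.range (R : E →ₗ[ℂ] F) :=
    R.codRestrict _ fun x => LinearMap.mem_range_self (R : E →ₗ[ℂ] F) x
  have hS : IsCompactOperator S :=
    isCompactOperator_of_locallyCompactSpace_dom S
  exact hS.clm_comp (LinearMap.range (R : E →ₗ[ℂ] F)).subtypeL

/-- An operator whose squared norms on finite orthonormal families have sum at most `C` is
approximated by operators of rank `m` up to an error of order `m ^ (-1/2)`. -/
theorem hasRankApprox_of_sum_norm_sq_le {A : E →L[ℂ] F} {C : ℝ}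
    (h : ∀ (n : ℕ) (x : Fin n → E), Orthonormal ℂ x → ∑ i, ‖A (x i)‖ ^ 2 ≤ C) (m : ℕ) {c : ℝ}
    (hc : 0 ≤ c) (hC : C < (m + 1) * c ^ 2) : HasRankApprox A m c := by
  by_contra hno
  -- Greedy construction: if V is the span of the vectors found so far, A P_V has rank at most m and
  -- so misses A by more than c. Some y witnesses this, and its normalized component orthogonal to V
  -- is the next vector.
  have key : ∀ n ≤ m + 1, ∃ x : Fin n → E, Orthonormal ℂ x ∧ ∀ i, c ≤ ‖A (x i)‖ := by
    intro n
    induction n with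
    | zero => exact fun _ => ⟨fun i => i.elim0, ⟨fun i => i.elim0, fun i => i.elim0⟩,
        fun i => i.elim0⟩
    | succ n ih =>
      intro hn
      obtain ⟨x, hx, hxc⟩ := ih (by omega)
      set V : Submodule ℂ E := Submodule.span ℂ (range x) with hV
      have hVfin : FiniteDimensional ℂ V := FiniteDimensional.span_of_finite ℂ (finite_range x)
      have hrank : LinearMap.rank ((A ∘L V.starProjection : E →L[ℂ] F) : E →ₗ[ℂ] F) ≤ m := by
        refine (LinearMap.rank_comp_le_right (V.starProjection : E →ₗ[ℂ] E)
          (A : E →ₗ[ℂ] F)).trans ?_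
        have h1 : LinearMap.rank (V.starProjection : E →ₗ[ℂ] E) = Module.rank ℂ V := by
          unfold LinearMap.rank
          rw [Submodule.range_starProjection]
        rw [h1, ← Module.finrank_eq_rank]
        have h2 : Module.finrank ℂ V ≤ n := (finrank_range_le_card (R := ℂ) x).trans (by simp)
        exact_mod_cast h2.trans (by omega)
      have hlt : ¬ ‖A - A ∘L V.starProjection‖ ≤ c := fun hle => hno ⟨_, hrank, hle⟩
      have : ∃ y, c * ‖y‖ < ‖(A - A ∘L V.starProjection) y‖ := by
        by_contra hcon
        push Not at hcon
        exact hlt (ContinuousLinearMap.opNorm_le_bound _ hc hcon)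
      obtain ⟨y, hy⟩ := this
      set z : E := y - V.starProjection y with hz
      have hAz : (A - A ∘L V.starProjection) y = A z := by simp [hz]
      rw [hAz] at hy
      -- Projecting shortens y, so normalizing z instead of y only improves the lower bound.
      have hzy : ‖z‖ ≤ ‖y‖ := by
        rw [hz, ← Submodule.starProjection_orthogonal_val]
        exact Submodule.norm_starProjection_apply_le _ _
      have hz0 : z ≠ 0 := by
        intro h0
        rw [h0, map_zero, norm_zero] at hy
        exact absurd hy (not_lt.2 (by positivity))
      have hzpos : 0 < ‖z‖ := norm_pos_iff.2 hz0
      have hzV : z ∈ Vᗮ := Submodule.sub_starProjection_mem_orthogonal y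
      refine ⟨Matrix.vecCons (((‖z‖⁻¹ : ℝ) : ℂ) • z) x,
        orthonormal_vecCons_iff.2 ⟨?_, fun i => ?_, hx⟩, fun i => ?_⟩
      · rw [norm_smul, Complex.norm_real, norm_inv, norm_norm, inv_mul_cancel₀ hzpos.ne']
      · rw [inner_smul_left, (Submodule.mem_orthogonal' V z).1 hzV _
          (Submodule.subset_span (mem_range_self i)), mul_zero]
      · refine Fin.cases ?_ (fun i => ?_) i
        · rw [Matrix.cons_val_zero, map_smul, norm_smul, Complex.norm_real, norm_inv, norm_norm,
            inv_mul_eq_div, le_div_iff₀ hzpos]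
          exact (mul_le_mul_of_nonneg_left hzy hc).trans hy.le
        · rw [Matrix.cons_val_succ]
          exact hxc i
  -- These m + 1 vectors force (m + 1) c² ≤ C, against `hC`.
  obtain ⟨x, hx, hxc⟩ := key (m + 1) le_rfl
  have h1 := h _ x hx
  have h2 : ∑ _i : Fin (m + 1), c ^ 2 ≤ ∑ i, ‖A (x i)‖ ^ 2 :=
    Finset.sum_le_sum fun i _ => pow_le_pow_left₀ hc (hxc i) 2
  simp only [Finset.sum_const, Finset.card_univ, Fintype.card_fin, nsmul_eq_mul] at h2
  push_cast at h2
  linarith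

end RankApprox

/-! ### Singular numbers bounded by finite-rank approximation. -/

section SingularNumbers

/-- On the sum of the eigenspaces for eigenvalues at least `μ`, a symmetric operator expands
norms by `μ`. -/
theorem le_norm_apply_of_mem_iSup_eigenspace {H : Type}
    [NormedAddCommGroup H] [InnerProductSpace ℂ H] {S : Module.End ℂ H} (hS : S.IsSymmetric)
    {μ : ℝ} (hμ : 0 ≤ μ) {x : H}
    (hx : x ∈ ⨆ ν ∈ Ici μ, Module.End.eigenspace S ((ν : ℝ) : ℂ)) : μ * ‖x‖ ≤ ‖S x‖ := by
  classical
  rw [iSup_subtype', Submodule.mem_iSup_iff_exists_finsupp] at hx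
  obtain ⟨f, hf, rfl⟩ := hx
  have hO := hS.orthogonalFamily_eigenspaces.comp (γ := Ici μ)
    (f := fun ν => ((ν : ℝ) : ℂ)) (fun a b hab => Subtype.ext (Complex.ofReal_injective hab))
  let l : ∀ ν : Ici μ, Module.End.eigenspace S (((ν : ℝ) : ℂ)) := fun ν => ⟨f ν, hf ν⟩
  have h1 := hO.norm_sum l f.support
  have h2 := hO.norm_sum (fun ν => ((ν : ℝ) : ℂ) • l ν) f.support
  have h3 : S (∑ ν ∈ f.support, f ν) = ∑ ν ∈ f.support, ((ν : ℝ) : ℂ) • f ν := by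
    rw [map_sum]
    exact Finset.sum_congr rfl fun ν _ => Module.End.mem_eigenspace_iff.1 (hf ν)
  simp only [Finsupp.sum]
  rw [h3]
  refine abs_le_of_sq_le_sq' ?_ (norm_nonneg _) |>.2
  have h1' : ‖∑ ν ∈ f.support, f ν‖ ^ 2 = ∑ ν ∈ f.support, ‖f ν‖ ^ 2 := h1
  have h2' : ‖∑ ν ∈ f.support, ((ν : ℝ) : ℂ) • f ν‖ ^ 2 =
      ∑ ν ∈ f.support, ‖((ν : ℝ) : ℂ) • f ν‖ ^ 2 := h2
  rw [mul_pow, h1', h2', Finset.mul_sum]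
  refine Finset.sum_le_sum fun ν _ => ?_
  rw [← mul_pow, norm_smul, Complex.norm_real, Real.norm_eq_abs, abs_of_nonneg (hμ.trans ν.2)]
  have := ν.2
  gcongr
  exact this

variable {H : Type} [NormedAddCommGroup H] [InnerProductSpace ℂ H] [CompleteSpace H]

/-- Both squares equal ⟨A*A x, x⟩, because |A| is self-adjoint with square A*A. -/
theorem norm_cfcAbs_apply (A : H →L[ℂ] H) (x : H) : ‖(CFC.abs A : H →L[ℂ] H) x‖ = ‖A x‖ := by
  have h1 : ContinuousLinearMap.adjoint (CFC.abs A : H →L[ℂ] H) = CFC.abs A :=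
    (CFC.abs_nonneg A).isSelfAdjoint.star_eq
  have h2 : (CFC.abs A : H →L[ℂ] H) * CFC.abs A = star A * A := CFC.abs_mul_abs A
  have h3 : ‖(CFC.abs A : H →L[ℂ] H) x‖ ^ 2 = ‖A x‖ ^ 2 := by
    rw [ContinuousLinearMap.apply_norm_sq_eq_inner_adjoint_left,
      ContinuousLinearMap.apply_norm_sq_eq_inner_adjoint_left, h1]
    change RCLike.re (inner ℂ (((CFC.abs A : H →L[ℂ] H) * CFC.abs A) x) x) = _
    rw [h2]
    rfl
  exact (pow_left_inj₀ (norm_nonneg _) (norm_nonneg _) two_ne_zero).1 h3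

theorem singularNumber_nonneg (A : H →L[ℂ] H) (j : ℕ) : 0 ≤ singularNumber A j :=
  Real.sSup_nonneg fun _ h => h.1.le

/-- One half of the min-max principle. The spectral subspace for eigenvalues at least μ has
dimension at least j + 1, more than the rank of R, so it contains some x ≠ 0 with R x = 0. There
μ‖x‖ ≤ ‖A x‖ = ‖(A - R) x‖ ≤ c‖x‖. -/
theorem singularNumber_le_of_hasRankApprox {A : H →L[ℂ] H} {j : ℕ} {c : ℝ}
    (h : HasRankApprox A j c) : singularNumber A j ≤ c := by
  refine Real.sSup_le ?_ h.nonneg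
  rintro μ ⟨hμ, hrank⟩
  obtain ⟨R, hR, hAR⟩ := h
  set M : Submodule ℂ H := ⨆ ν ∈ Ici μ,
      Module.End.eigenspace ((CFC.abs A : H →L[ℂ] H) : Module.End ℂ H) ((ν : ℝ) : ℂ) with hM
  have hker : ∃ x ∈ M, x ≠ 0 ∧ R x = 0 := by
    by_contra hcon
    push Not at hcon
    let f : M →ₗ[ℂ] LinearMap.range (R : H →ₗ[ℂ] H) :=
      (R : H →ₗ[ℂ] H).rangeRestrict ∘ₗ M.subtype
    have hf : Function.Injective f := by
      rw [injective_iff_map_eq_zero]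
      intro x hx
      by_contra hx0
      refine hcon x x.2 (fun h0 => hx0 (Subtype.ext h0)) ?_
      exact congrArg Subtype.val hx
    have h1 := (hrank.trans (LinearMap.rank_le_of_injective f hf)).trans hR
    have h2 : j + 1 ≤ j := by exact_mod_cast h1
    omega
  obtain ⟨x, hxM, hx0, hRx⟩ := hker
  have hsym : ((CFC.abs A : H →L[ℂ] H) : Module.End ℂ H).IsSymmetric :=
    ((ContinuousLinearMap.isSelfAdjoint_iff_isSymmetric).1 (CFC.abs_nonneg A).isSelfAdjoint)
  have h1 : μ * ‖x‖ ≤ ‖(CFC.abs A : H →L[ℂ] H) x‖ :=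
    le_norm_apply_of_mem_iSup_eigenspace hsym hμ.le hxM
  rw [norm_cfcAbs_apply] at h1
  have h2 : ‖A x‖ ≤ c * ‖x‖ := by
    have h3 : A x = (A - R) x := by simp [hRx]
    rw [h3]
    exact (A - R).le_of_opNorm_le hAR x
  exact le_of_mul_le_mul_right (h1.trans h2) (norm_pos_iff.2 hx0)

/-- An operator whose distance to the operators of rank at most `2 n` is `O(n ^ (-3/2))` belongs
to `𝔖_p` for every `p > 2/3`. -/
theorem memSchatten_of_hasRankApprox {A : H →L[ℂ] H} {C : ℝ}
    (h : ∀ n : ℕ, HasRankApprox A (2 * n) (C * ((n : ℝ) + 1) ^ (-(3 / 2 : ℝ)))) {p : ℝ}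
    (hp : 2 / 3 < p) : MemSchatten p A := by
  have hp0 : 0 < p := by linarith
  have hC : 0 ≤ C := by
    have := (h 0).nonneg
    simpa using this
  constructor
  · choose R hR1 hR2 using h
    have hlim : Tendsto (fun n : ℕ => C * ((n : ℝ) + 1) ^ (-(3 / 2 : ℝ))) atTop (nhds 0) := by
      have h1 : Tendsto (fun n : ℕ => (n : ℝ) + 1) atTop atTop :=
        tendsto_atTop_add_const_right _ _ tendsto_natCast_atTop_atTop
      simpa using ((tendsto_rpow_neg_atTop (by norm_num : (0 : ℝ) < 3 / 2)).comp h1).const_mul C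
    refine isCompactOperator_of_tendsto (F := R) (l := atTop) ?_
      (Eventually.of_forall fun n => isCompactOperator_of_rank_le (hR1 n))
    rw [tendsto_iff_norm_sub_tendsto_zero]
    refine squeeze_zero (fun n => norm_nonneg _) (fun n => ?_) hlim
    rw [norm_sub_rev]
    exact hR2 n
  · have hbound : ∀ j : ℕ, singularNumber A j ^ p ≤
        (C * 2 ^ (3 / 2 : ℝ)) ^ p * ((j : ℝ) + 1) ^ (-(3 / 2 * p)) := by
      intro j
      -- Rank j is needed but only even ranks are available: n = ⌊j/2⌋ serves, and n + 1 ≥ (j + 1)/2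
      -- costs the factor 2^(3/2).
      have h1 : singularNumber A j ≤ C * (((j / 2 : ℕ) : ℝ) + 1) ^ (-(3 / 2 : ℝ)) :=
        singularNumber_le_of_hasRankApprox ((h (j / 2)).mono (by omega) le_rfl)
      have h2 : ((j : ℝ) + 1) / 2 ≤ ((j / 2 : ℕ) : ℝ) + 1 := by
        have : j + 1 ≤ 2 * (j / 2 + 1) := by omega
        have : (j : ℝ) + 1 ≤ 2 * (((j / 2 : ℕ) : ℝ) + 1) := by exact_mod_cast this
        linarith
      have h3 : (((j / 2 : ℕ) : ℝ) + 1) ^ (-(3 / 2 : ℝ)) ≤ (((j : ℝ) + 1) / 2) ^ (-(3 / 2 : ℝ)) :=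
        Real.rpow_le_rpow_of_nonpos (by positivity) h2 (by norm_num)
      have h4 : (((j : ℝ) + 1) / 2) ^ (-(3 / 2 : ℝ)) =
          2 ^ (3 / 2 : ℝ) * ((j : ℝ) + 1) ^ (-(3 / 2 : ℝ)) := by
        rw [Real.div_rpow (by positivity) (by norm_num), Real.rpow_neg (by norm_num : (0:ℝ) ≤ 2),
          div_inv_eq_mul, mul_comm]
      have h5 : singularNumber A j ≤ C * 2 ^ (3 / 2 : ℝ) * ((j : ℝ) + 1) ^ (-(3 / 2 : ℝ)) := by
        rw [mul_assoc, ← h4]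
        exact h1.trans (by gcongr)
      refine (Real.rpow_le_rpow (singularNumber_nonneg A j) h5 hp0.le).trans_eq ?_
      rw [Real.mul_rpow (by positivity) (by positivity), ← Real.rpow_mul (by positivity)]
      ring_nf
    refine Summable.of_nonneg_of_le (fun j => Real.rpow_nonneg (singularNumber_nonneg A j) p)
      hbound (Summable.mul_left _ ?_)
    have h6 : Summable fun n : ℕ => (n : ℝ) ^ (-(3 / 2 * p)) :=
      Real.summable_nat_rpow.2 (by linarith)
    simpa using (summable_nat_add_iff 1).2 h6

end SingularNumbers

/-! ### Integral operators with square integrable kernels -/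

section KernelOperators

open scoped ENNReal

variable {α : Type} [MeasurableSpace α] {μ : Measure α}

theorem enorm_complex_ofReal (r : ℝ) : ‖(r : ℂ)‖ₑ = ‖r‖ₑ := by
  rw [← ofReal_norm, ← ofReal_norm, Complex.norm_real]

theorem sq_lintegral_mul_le {f g : α → ℝ≥0∞} (hf : AEMeasurable f μ) (hg : AEMeasurable g μ) :
    (∫⁻ x, f x * g x ∂μ) ^ 2 ≤ (∫⁻ x, f x ^ 2 ∂μ) * ∫⁻ x, g x ^ 2 ∂μ := by
  have h := ENNReal.lintegral_mul_le_Lp_mul_Lq μ Real.HolderConjugate.two_two hf hg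
  simp only [Pi.mul_apply, ENNReal.rpow_two] at h
  refine (pow_le_pow_left₀ zero_le h 2).trans_eq ?_
  rw [mul_pow, ← ENNReal.rpow_two, ← ENNReal.rpow_two, ← ENNReal.rpow_mul, ← ENNReal.rpow_mul]
  norm_num

theorem lintegral_enorm_sq_eq (f : Lp ℂ 2 μ) : ∫⁻ x, ‖f x‖ₑ ^ 2 ∂μ = ‖f‖ₑ ^ 2 := by
  have h := eLpNorm_nnreal_pow_eq_lintegral (μ := μ) (f := f) (p := 2) two_ne_zero
  have h2 : ((2 : NNReal) : ℝ) = 2 := rfl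
  simp only [h2, ENNReal.rpow_two] at h
  rw [← h, Lp.enorm_def]
  rfl

theorem memLp_two_of_lintegral_enorm_sq_lt_top {f : α → ℂ} (hf : AEStronglyMeasurable f μ)
    (h : ∫⁻ x, ‖f x‖ₑ ^ 2 ∂μ < ∞) : MemLp f 2 μ := by
  refine ⟨hf, ?_⟩
  rw [eLpNorm_lt_top_iff_lintegral_rpow_enorm_lt_top two_ne_zero (by norm_num)]
  simpa using h

theorem norm_le_mul_norm_of_lintegral_le {f g : Lp ℂ 2 μ} {c : ℝ} (hc : 0 ≤ c)
    (h : ∫⁻ x, ‖f x‖ₑ ^ 2 ∂μ ≤ ENNReal.ofReal (c ^ 2) * ∫⁻ x, ‖g x‖ₑ ^ 2 ∂μ) :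
    ‖f‖ ≤ c * ‖g‖ := by
  rw [lintegral_enorm_sq_eq, lintegral_enorm_sq_eq, ← ofReal_norm, ← ofReal_norm,
    ← ENNReal.ofReal_pow (norm_nonneg _), ← ENNReal.ofReal_pow (norm_nonneg _),
    ← ENNReal.ofReal_mul (by positivity), ENNReal.ofReal_le_ofReal_iff (by positivity),
    ← mul_pow] at h
  exact abs_le_of_sq_le_sq' h (by positivity) |>.2

/-- A real kernel that is measurable and square integrable. -/
structure IsHSKernel (μ : Measure α) (k : α → α → ℝ) : Prop where
  measurable : Measurable (Function.uncurry k)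
  lintegral_lt_top : ∫⁻ x, ∫⁻ y, ‖k x y‖ₑ ^ 2 ∂μ ∂μ < ∞

variable {k : α → α → ℝ}

theorem IsHSKernel.measurable_row (hk : IsHSKernel μ k) (x : α) : Measurable (k x) :=
  hk.measurable.comp measurable_prodMk_left

theorem IsHSKernel.ae_lt_top [SFinite μ] (hk : IsHSKernel μ k) :
    ∀ᵐ x ∂μ, ∫⁻ y, ‖k x y‖ₑ ^ 2 ∂μ < ∞ := by
  refine MeasureTheory.ae_lt_top ?_ hk.lintegral_lt_top.ne
  exact Measurable.lintegral_prod_right (f := fun x y => ‖k x y‖ₑ ^ 2)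
    (hk.measurable.enorm.pow_const 2)

theorem memLp_row {k : α → ℝ} (hk : Measurable k) (h : ∫⁻ y, ‖k y‖ₑ ^ 2 ∂μ < ∞) :
    MemLp (fun y => (k y : ℂ)) 2 μ :=
  memLp_two_of_lintegral_enorm_sq_lt_top
    (Complex.measurable_ofReal.comp hk).aestronglyMeasurable (by simpa only [enorm_complex_ofReal] using h)

theorem integrable_row_mul {k : α → ℝ} (hk : Measurable k) (h : ∫⁻ y, ‖k y‖ₑ ^ 2 ∂μ < ∞)
    (f : Lp ℂ 2 μ) : Integrable (fun y => (k y : ℂ) * f y) μ :=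
  (memLp_row hk h).integrable_mul (Lp.memLp f)

theorem enorm_integral_mul_sq_le {k : α → ℝ} (hk : Measurable k) (f : Lp ℂ 2 μ) :
    ‖∫ y, (k y : ℂ) * f y ∂μ‖ₑ ^ 2 ≤ (∫⁻ y, ‖k y‖ₑ ^ 2 ∂μ) * ∫⁻ y, ‖f y‖ₑ ^ 2 ∂μ := by
  have h1 : ‖∫ y, (k y : ℂ) * f y ∂μ‖ₑ ≤ ∫⁻ y, ‖k y‖ₑ * ‖f y‖ₑ ∂μ := by
    refine (enorm_integral_le_lintegral_enorm _).trans_eq (lintegral_congr fun y => ?_)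
    rw [enorm_mul, enorm_complex_ofReal]
  exact (pow_le_pow_left₀ zero_le h1 2).trans
    (sq_lintegral_mul_le hk.enorm.aemeasurable (Lp.aestronglyMeasurable f).enorm)

theorem aestronglyMeasurable_integral_kernel [SFinite μ] (hk : Measurable (Function.uncurry k))
    (f : Lp ℂ 2 μ) : AEStronglyMeasurable (fun x => ∫ y, (k x y : ℂ) * f y ∂μ) μ := by
  have h1 : AEStronglyMeasurable (fun p : α × α => (k p.1 p.2 : ℂ) * f p.2) (μ.prod μ) :=
    ((Complex.measurable_ofReal.comp hk).aestronglyMeasurable).mul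
      ((Lp.aestronglyMeasurable f).comp_snd)
  exact h1.integral_prod_right'

theorem IsHSKernel.lintegral_enorm_integral_sq_le (hk : IsHSKernel μ k) (f : Lp ℂ 2 μ) :
    ∫⁻ x, ‖∫ y, (k x y : ℂ) * f y ∂μ‖ₑ ^ 2 ∂μ ≤
      (∫⁻ x, ∫⁻ y, ‖k x y‖ₑ ^ 2 ∂μ ∂μ) * ∫⁻ y, ‖f y‖ₑ ^ 2 ∂μ := by
  rw [← lintegral_mul_const' _ _ (by
    rw [lintegral_enorm_sq_eq]
    exact ENNReal.pow_ne_top enorm_ne_top)]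
  exact lintegral_mono fun x => enorm_integral_mul_sq_le (hk.measurable_row x) f

theorem IsHSKernel.memLp_integral [SFinite μ] (hk : IsHSKernel μ k) (f : Lp ℂ 2 μ) :
    MemLp (fun x => ∫ y, (k x y : ℂ) * f y ∂μ) 2 μ := by
  refine memLp_two_of_lintegral_enorm_sq_lt_top (aestronglyMeasurable_integral_kernel hk.measurable f)
    ((hk.lintegral_enorm_integral_sq_le f).trans_lt ?_)
  rw [lintegral_enorm_sq_eq]
  exact ENNReal.mul_lt_top hk.lintegral_lt_top (ENNReal.pow_lt_top enorm_lt_top)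

variable [SFinite μ]

/-- The integral operator on `L²` with a square integrable kernel. -/
noncomputable def kernelOp (hk : IsHSKernel μ k) : Lp ℂ 2 μ →L[ℂ] Lp ℂ 2 μ :=
  LinearMap.mkContinuous
    { toFun := fun f => (hk.memLp_integral f).toLp _
      map_add' := fun f g => by
        rw [← MemLp.toLp_add]
        refine (MemLp.toLp_eq_toLp_iff _ _).2 ?_
        filter_upwards [hk.ae_lt_top] with x hx
        rw [Pi.add_apply, ← integral_add (integrable_row_mul (hk.measurable_row x) hx f)
          (integrable_row_mul (hk.measurable_row x) hx g)]
        refine integral_congr_ae ?_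
        filter_upwards [Lp.coeFn_add f g] with y hy
        rw [hy, Pi.add_apply, mul_add]
      map_smul' := fun c f => by
        rw [RingHom.id_apply, ← MemLp.toLp_const_smul]
        refine (MemLp.toLp_eq_toLp_iff _ _).2 ?_
        refine Eventually.of_forall fun x => ?_
        simp only [Pi.smul_apply]
        rw [← integral_smul]
        refine integral_congr_ae ?_
        filter_upwards [Lp.coeFn_smul c f] with y hy
        rw [hy, Pi.smul_apply, smul_eq_mul, smul_eq_mul, mul_left_comm] }
    (√(∫⁻ x, ∫⁻ y, ‖k x y‖ₑ ^ 2 ∂μ ∂μ).toReal) fun f => by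
      refine norm_le_mul_norm_of_lintegral_le (Real.sqrt_nonneg _) ?_
      rw [Real.sq_sqrt ENNReal.toReal_nonneg, ENNReal.ofReal_toReal hk.lintegral_lt_top.ne]
      refine (lintegral_congr_ae ?_).trans_le (hk.lintegral_enorm_integral_sq_le f)
      filter_upwards [(hk.memLp_integral f).coeFn_toLp] with x hx
      simp only [LinearMap.coe_mk, AddHom.coe_mk]
      rw [hx]

theorem kernelOp_ae_eq (hk : IsHSKernel μ k) (f : Lp ℂ 2 μ) :
    kernelOp hk f =ᵐ[μ] fun x => ∫ y, (k x y : ℂ) * f y ∂μ :=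
  (hk.memLp_integral f).coeFn_toLp

omit [SFinite μ] in
-- Bessel's inequality for one row of the kernel: since k is real, the integrals are the inner
-- products of the row with the f i.
theorem sum_enorm_integral_sq_le {k : α → ℝ} (hk : Measurable k) (h : ∫⁻ y, ‖k y‖ₑ ^ 2 ∂μ < ∞)
    {n : ℕ} {f : Fin n → Lp ℂ 2 μ} (hf : Orthonormal ℂ f) :
    ∑ i, ‖∫ y, (k y : ℂ) * f i y ∂μ‖ₑ ^ 2 ≤ ∫⁻ y, ‖k y‖ₑ ^ 2 ∂μ := by
  set u : Lp ℂ 2 μ := (memLp_row hk h).toLp _ with hu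
  have hu2 : u =ᵐ[μ] fun y => (k y : ℂ) := (memLp_row hk h).coeFn_toLp
  have h1 : ∀ i, ∫ y, (k y : ℂ) * f i y ∂μ = inner ℂ u (f i) := by
    intro i
    rw [L2.inner_def]
    refine integral_congr_ae ?_
    filter_upwards [hu2] with y hy
    rw [hy, RCLike.inner_apply, Complex.conj_ofReal, mul_comm]
  have h2 : ∫⁻ y, ‖k y‖ₑ ^ 2 ∂μ = ‖u‖ₑ ^ 2 := by
    rw [← lintegral_enorm_sq_eq]
    refine lintegral_congr_ae ?_
    filter_upwards [hu2] with y hy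
    rw [hy, enorm_complex_ofReal]
  have h3 := hf.sum_inner_products_le (s := Finset.univ) u
  simp only [h1]
  rw [h2, ← ofReal_norm, ← ENNReal.ofReal_pow (norm_nonneg _)]
  refine le_trans (le_of_eq ?_) (ENNReal.ofReal_le_ofReal h3)
  rw [ENNReal.ofReal_sum_of_nonneg fun i _ => by positivity]
  refine Finset.sum_congr rfl fun i _ => ?_
  rw [← norm_inner_symm, ENNReal.ofReal_pow (norm_nonneg _), ofReal_norm]

/-- Operators with square integrable kernels are approximated by operators of rank `m` up to an
error of order `m ^ (-1/2)`. -/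
theorem exists_hasRankApprox_kernelOp (hk : IsHSKernel μ k) :
    ∃ C : ℝ, ∀ m : ℕ, HasRankApprox (kernelOp hk) m (C * ((m : ℝ) + 1) ^ (-(1 / 2 : ℝ))) := by
  set D : ℝ := (∫⁻ x, ∫⁻ y, ‖k x y‖ₑ ^ 2 ∂μ ∂μ).toReal with hD
  have hD0 : 0 ≤ D := ENNReal.toReal_nonneg
  -- D + 1 in place of D makes the inequality required by `hasRankApprox_of_sum_norm_sq_le` strict.
  refine ⟨√(D + 1), fun m => hasRankApprox_of_sum_norm_sq_le (C := D) ?_ m (by positivity) ?_⟩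
  · intro n f hf
    have h1 : ∑ i, ‖kernelOp hk (f i)‖ₑ ^ 2 ≤ ∫⁻ x, ∫⁻ y, ‖k x y‖ₑ ^ 2 ∂μ ∂μ := by
      simp_rw [← lintegral_enorm_sq_eq]
      rw [← lintegral_finsetSum' _ fun i _ => (Lp.aestronglyMeasurable _).enorm.pow_const 2]
      refine lintegral_mono_ae ?_
      have h2 : ∀ᵐ x ∂μ, ∀ i, kernelOp hk (f i) x = ∫ y, (k x y : ℂ) * f i y ∂μ :=
        ae_all_iff.2 fun i => kernelOp_ae_eq hk (f i)
      filter_upwards [h2, hk.ae_lt_top] with x hx hx'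
      simp only [hx]
      exact sum_enorm_integral_sq_le (hk.measurable_row x) hx' hf
    have h2 := ENNReal.toReal_mono hk.lintegral_lt_top.ne h1
    rw [ENNReal.toReal_sum fun i _ => ENNReal.pow_ne_top enorm_ne_top] at h2
    simpa using h2
  · rw [mul_pow, Real.sq_sqrt (by positivity), ← Real.rpow_natCast, ← Real.rpow_mul (by positivity)]
    norm_num
    rw [Real.rpow_neg_one]
    have : (0 : ℝ) < m + 1 := by positivity
    field_simp
    linarith

end KernelOperators

/-! ### Weighted Volterra operators -/

section Volterra

open scoped ENNReal

variable {μ : Measure ℝ} [IsFiniteMeasure μ] {w : ℝ → ℝ}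

/-- Each row is dominated by w and μ is finite. The lemma serves both the Volterra kernel and its
discretization. -/
theorem isHSKernel_ite {r : ℝ → ℝ → Prop} [∀ x y, Decidable (r x y)]
    (hr : MeasurableSet {p : ℝ × ℝ | r p.1 p.2}) (hw : Measurable w)
    (hw2 : ∫⁻ y, ‖w y‖ₑ ^ 2 ∂μ < ∞) : IsHSKernel μ fun x y => if r x y then w y else 0 := by
  refine ⟨Measurable.ite hr (hw.comp measurable_snd) measurable_const, ?_⟩
  have h1 : ∀ x, ∫⁻ y, ‖(if r x y then w y else 0 : ℝ)‖ₑ ^ 2 ∂μ ≤ ∫⁻ y, ‖w y‖ₑ ^ 2 ∂μ := by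
    refine fun x => lintegral_mono fun y => ?_
    split_ifs <;> simp
  refine (lintegral_mono h1).trans_lt ?_
  rw [lintegral_const]
  exact ENNReal.mul_lt_top hw2 (measure_lt_top μ univ)

theorem isHSKernel_volterra (hw : Measurable w) (hw2 : ∫⁻ y, ‖w y‖ₑ ^ 2 ∂μ < ∞) :
    IsHSKernel μ fun x y => if y < x then w y else 0 :=
  isHSKernel_ite (r := fun x y => y < x) (measurableSet_lt measurable_snd measurable_fst) hw hw2

/-- `u ↦ ∫_{y < x} w(y) u(y)`. -/
noncomputable def volterraOp (hw : Measurable w) (hw2 : ∫⁻ y, ‖w y‖ₑ ^ 2 ∂μ < ∞) : Lp ℂ 2 μ →L[ℂ] Lp ℂ 2 μ :=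
  kernelOp (isHSKernel_volterra hw hw2)

theorem isHSKernel_step {j : ℝ → ℕ} (hj : Measurable j) (hw : Measurable w)
    (hw2 : ∫⁻ y, ‖w y‖ₑ ^ 2 ∂μ < ∞) : IsHSKernel μ fun x y => if j y < j x then w y else 0 :=
  isHSKernel_ite (r := fun x y => j y < j x)
    (measurableSet_lt (hj.comp measurable_snd) (hj.comp measurable_fst)) hw hw2

/-- The discretization of the Volterra operator along a partition into `n + 1` cells has rank at
most `n`. -/
theorem rank_kernelOp_step_le {j : ℝ → ℕ} (hj : Measurable j) (hw : Measurable w)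
    (hw2 : ∫⁻ y, ‖w y‖ₑ ^ 2 ∂μ < ∞) {n : ℕ} (hjn : ∀ x, j x ≤ n) :
    LinearMap.rank ((kernelOp (isHSKernel_step hj hw hw2) : Lp ℂ 2 μ →L[ℂ] Lp ℂ 2 μ) :
      Lp ℂ 2 μ →ₗ[ℂ] Lp ℂ 2 μ) ≤ n := by
  let e : Fin n → Lp ℂ 2 μ := fun i =>
    indicatorConstLp 2 (hj (measurableSet_singleton ((i : ℕ) + 1))) (measure_ne_top μ _) (1 : ℂ)
  have hsub : LinearMap.range ((kernelOp (isHSKernel_step hj hw hw2) :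
      Lp ℂ 2 μ →L[ℂ] Lp ℂ 2 μ) : Lp ℂ 2 μ →ₗ[ℂ] Lp ℂ 2 μ) ≤ Submodule.span ℂ (range e) := by
    rintro _ ⟨f, rfl⟩
    let c : ℕ → ℂ := fun i => ∫ y, ((if j y < i then w y else 0 : ℝ) : ℂ) * f y ∂μ
    -- The image takes the value c (j x) at x, so it is constant on cells. Since c 0 = 0, cell 0
    -- contributes nothing, and n of the n + 1 cells suffice.
    have hf : kernelOp (isHSKernel_step hj hw hw2) f = ∑ i : Fin n, c (i + 1) • e i := by
      refine Lp.ext ?_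
      have h1 : ∀ᵐ x ∂μ, ∀ i : Fin n, (c (i + 1) • e i : Lp ℂ 2 μ) x =
          c (i + 1) * (j ⁻¹' {(i : ℕ) + 1}).indicator (fun _ => (1 : ℂ)) x := by
        refine ae_all_iff.2 fun i => ?_
        filter_upwards [Lp.coeFn_smul (c (i + 1)) (e i), indicatorConstLp_coeFn (p := 2)
          (hs := hj (measurableSet_singleton ((i : ℕ) + 1))) (hμs := measure_ne_top μ _)
          (c := (1 : ℂ))] with x hx hx'
        rw [hx, Pi.smul_apply, smul_eq_mul, hx']
      have h2 := Lp.coeFn_finsetSum (Finset.univ : Finset (Fin n)) fun i => c (i + 1) • e i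
      filter_upwards [kernelOp_ae_eq (isHSKernel_step hj hw hw2) f, h1, h2] with x hx hx1 hx2
      rw [hx, hx2, Finset.sum_apply]
      simp only [hx1]
      change c (j x) = _
      rcases Nat.eq_zero_or_pos (j x) with h0 | h0
      · have hc : c 0 = 0 := by simp [c]
        rw [h0, hc, Finset.sum_eq_zero]
        intro i _
        rw [indicator_of_notMem, mul_zero]
        simp [h0]
      · have hlt : j x - 1 < n := by have := hjn x; omega
        rw [Finset.sum_eq_single ⟨j x - 1, hlt⟩]
        · have : j x - 1 + 1 = j x := by omega
          simp [this]
        · intro i _ hi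
          rw [indicator_of_notMem, mul_zero]
          intro hmem
          refine hi (Fin.ext ?_)
          have : j x = i + 1 := hmem
          simp [this]
        · simp
    change kernelOp (isHSKernel_step hj hw hw2) f ∈ _
    rw [hf]
    exact Submodule.sum_mem _ fun i _ =>
      Submodule.smul_mem _ _ (Submodule.subset_span (mem_range_self i))
  refine (Submodule.rank_mono hsub).trans ?_
  refine (rank_span_le _).trans ?_
  exact Cardinal.mk_range_le.trans_eq (by simp)

/-- As j is monotone, the conditions y < x and j y < j x differ only when x and y share a cell. The
difference of the operators is thus block diagonal, and on each block Cauchy–Schwarz bounds the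
squared norm by the μ-mass times the w²-mass of the cell, at most M². -/
theorem hasRankApprox_volterraOp_of_partition (hw : Measurable w)
    (hw2 : ∫⁻ y, ‖w y‖ₑ ^ 2 ∂μ < ∞) {j : ℝ → ℕ} (hj : Monotone j) {n : ℕ} (hjn : ∀ x, j x ≤ n)
    {M : ℝ} (hM : 0 ≤ M) (hM1 : ∀ i, μ (j ⁻¹' {i}) ≤ ENNReal.ofReal M)
    (hM2 : ∀ i, ∫⁻ y in j ⁻¹' {i}, ‖w y‖ₑ ^ 2 ∂μ ≤ ENNReal.ofReal M) :
    HasRankApprox (volterraOp hw hw2) n M := by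
  have hjm : Measurable j := hj.measurable
  have hcell : ∀ i, MeasurableSet (j ⁻¹' {i}) := fun i => hjm (measurableSet_singleton i)
  refine ⟨kernelOp (isHSKernel_step hjm hw hw2), rank_kernelOp_step_le hjm hw hw2 hjn,
    ContinuousLinearMap.opNorm_le_bound _ hM fun f => ?_⟩
  refine norm_le_mul_norm_of_lintegral_le hM ?_
  set A := volterraOp hw hw2
  set R := kernelOp (isHSKernel_step hjm hw hw2)
  have hpt : ∀ᵐ x ∂μ, ‖(A - R) f x‖ₑ ^ 2 ≤
      ENNReal.ofReal M * ∫⁻ y, (if j y = j x then ‖f y‖ₑ ^ 2 else 0) ∂μ := by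
    have h0 : (A - R) f = A f - R f := rfl
    rw [h0]
    filter_upwards [Lp.coeFn_sub (A f) (R f), kernelOp_ae_eq (isHSKernel_volterra hw hw2) f,
      kernelOp_ae_eq (isHSKernel_step hjm hw hw2) f, (isHSKernel_volterra hw hw2).ae_lt_top,
      (isHSKernel_step hjm hw hw2).ae_lt_top] with x h1 h2 h3 h4 h5
    have h2' : A f x = _ := h2
    have h3' : R f x = _ := h3
    rw [h1, Pi.sub_apply, h2', h3', ← integral_sub
      (integrable_row_mul ((isHSKernel_volterra hw hw2).measurable_row x) h4 f)
      (integrable_row_mul ((isHSKernel_step hjm hw hw2).measurable_row x) h5 f)]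
    have h6 : ‖∫ y, (((if y < x then w y else 0 : ℝ) : ℂ) * f y -
        ((if j y < j x then w y else 0 : ℝ) : ℂ) * f y) ∂μ‖ₑ ≤
        ∫⁻ y, (j ⁻¹' {j x}).indicator (fun y => ‖w y‖ₑ) y *
          (if j y = j x then ‖f y‖ₑ else 0) ∂μ := by
      refine (enorm_integral_le_lintegral_enorm _).trans (lintegral_mono fun y => ?_)
      rcases lt_trichotomy (j y) (j x) with h | h | h
      · have : y < x := by
          by_contra hcon
          exact absurd (hj (not_lt.1 hcon)) (not_le.2 h)
        simp [this, h]
      · have hmem : y ∈ j ⁻¹' {j x} := h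
        rw [indicator_of_mem hmem]
        simp only [h, lt_irrefl, if_false, if_true, Complex.ofReal_zero, zero_mul, sub_zero]
        split_ifs
        · rw [enorm_mul, enorm_complex_ofReal]
        · simp
      · have h' : ¬ y < x := fun hcon => absurd (hj hcon.le) (not_le.2 h)
        simp [h', h.not_gt]
    refine (pow_le_pow_left₀ zero_le h6 2).trans ?_
    refine (sq_lintegral_mul_le ((hw.enorm.indicator (hcell _)).aemeasurable) ?_).trans ?_
    · have : (fun y => if j y = j x then ‖f y‖ₑ else 0) =
          (j ⁻¹' {j x}).indicator fun y => ‖f y‖ₑ := by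
        funext y
        by_cases h : j y = j x <;> simp [h]
      rw [this]
      exact (Lp.aestronglyMeasurable f).enorm.indicator (hcell _)
    · refine mul_le_mul' (le_trans (le_of_eq ?_) (hM2 (j x))) (lintegral_mono fun y => ?_)
      · rw [← lintegral_indicator (hcell _)]
        refine lintegral_congr fun y => ?_
        by_cases h : y ∈ j ⁻¹' {j x}
        · rw [indicator_of_mem h, indicator_of_mem h]
        · rw [indicator_of_notMem h, indicator_of_notMem h, zero_pow two_ne_zero]
      · dsimp only
        split_ifs <;> simp
  refine (lintegral_mono_ae hpt).trans ?_
  rw [lintegral_const_mul' _ _ ENNReal.ofReal_ne_top]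
  have hmeas : AEMeasurable (Function.uncurry fun x y => if j y = j x then ‖f y‖ₑ ^ 2 else 0)
      (μ.prod μ) := by
    have hS : MeasurableSet {p : ℝ × ℝ | j p.2 = j p.1} :=
      measurableSet_eq_fun (hjm.comp measurable_snd) (hjm.comp measurable_fst)
    have : (Function.uncurry fun x y => if j y = j x then ‖f y‖ₑ ^ 2 else 0) =
        {p : ℝ × ℝ | j p.2 = j p.1}.indicator fun p => ‖f p.2‖ₑ ^ 2 := by
      funext p
      simp [indicator_apply, Function.uncurry]
    rw [this]
    exact ((Lp.aestronglyMeasurable f).enorm.pow_const 2).comp_snd.indicator hS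
  -- Cauchy–Schwarz has used one factor M, the w²-mass. Integrating in x first yields the second
  -- one, the μ-mass of the cell of y.
  rw [lintegral_lintegral_swap hmeas]
  have h7 : ∀ y, ∫⁻ x, (if j y = j x then ‖f y‖ₑ ^ 2 else 0) ∂μ ≤
      ENNReal.ofReal M * ‖f y‖ₑ ^ 2 := by
    intro y
    have : (fun x => if j y = j x then ‖f y‖ₑ ^ 2 else 0) =
        (j ⁻¹' {j y}).indicator fun _ => ‖f y‖ₑ ^ 2 := by
      funext x
      by_cases h : j y = j x
      · simp [h]
      · simp [h, Ne.symm h]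
    rw [this, lintegral_indicator_const (hcell _), mul_comm]
    exact mul_le_mul' (hM1 _) le_rfl
  refine (mul_le_mul' le_rfl (lintegral_mono h7)).trans_eq ?_
  rw [lintegral_const_mul' _ _ ENNReal.ofReal_ne_top, ← mul_assoc, ← ENNReal.ofReal_mul hM, sq]

/-- The part of the line where the distribution function of a measure without atoms takes values
in `[a, b]` has measure at most `b - a`. -/
theorem measure_le_of_cdf_mem_Icc {ν : Measure ℝ} [IsFiniteMeasure ν] [NullSingletonClass ν] {s : Set ℝ}
    (hs : MeasurableSet s) {a b : ℝ} (h : ∀ x ∈ s, ν.real (Iio x) ∈ Icc a b) :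
    ν s ≤ ENNReal.ofReal (b - a) := by
  -- Inner regularity reduces to compact K ⊆ s, whose infimum and supremum belong to s, so the
  -- bounds on the distribution function apply at both ends.
  rw [hs.measure_eq_iSup_isCompact]
  refine iSup₂_le fun K hK => iSup_le fun hKc => ?_
  rcases K.eq_empty_or_nonempty with rfl | hne
  · simp
  have h1 := hKc.sInf_mem hne
  have h2 := hKc.sSup_mem hne
  have hsub : K ⊆ Icc (sInf K) (sSup K) := fun x hx =>
    ⟨csInf_le hKc.bddBelow hx, le_csSup hKc.bddAbove hx⟩
  have hle : sInf K ≤ sSup K := (hsub h1).2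
  refine (measure_mono hsub).trans ?_
  rw [← Ico_ae_eq_Icc.measure_eq, ← Iio_sdiff_Iio,
    measure_sdiff (Iio_subset_Iio hle) measurableSet_Iio.nullMeasurableSet (measure_ne_top _ _),
    ← ofReal_measureReal, ← ofReal_measureReal, ← ENNReal.ofReal_sub _ measureReal_nonneg]
  exact ENNReal.ofReal_le_ofReal (by linarith [(h _ (hK h1)).1, (h _ (hK h2)).2])

/-- A finite measure without atoms on the line has monotone partitions into cells of equal
measure. -/
theorem exists_monotone_partition (ν : Measure ℝ) [IsFiniteMeasure ν] [NullSingletonClass ν] (n : ℕ) :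
    ∃ j : ℝ → ℕ, Monotone j ∧ (∀ x, j x ≤ n) ∧
      ∀ i, ν (j ⁻¹' {i}) ≤ ENNReal.ofReal (ν.real univ / (n + 1)) := by
  rcases eq_or_ne ν 0 with rfl | hν
  · exact ⟨fun _ => 0, monotone_const, fun _ => n.zero_le, fun i => by simp⟩
  have hV : 0 < ν.real univ := 
    ENNReal.toReal_pos (Measure.measure_univ_pos.2 hν).ne' (measure_ne_top _ _)
  set V := ν.real univ
  have hmono : Monotone fun x => ν.real (Iio x) := fun x y hxy =>
    measureReal_mono (Iio_subset_Iio hxy)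
  -- The cutoff at n matters only where the distribution function reaches its maximum V and the
  -- floor would be n + 1; such points join the last cell.
  let j : ℝ → ℕ := fun x => min ⌊(n + 1) * ν.real (Iio x) / V⌋₊ n
  have hj : Monotone j := fun x y hxy => by
    refine min_le_min_right _ (Nat.floor_mono ?_)
    have := hmono hxy
    dsimp only at this
    gcongr
  refine ⟨j, hj, fun x => min_le_right _ _, fun i => ?_⟩
  have h := measure_le_of_cdf_mem_Icc (ν := ν) (s := j ⁻¹' {i})
    (hj.measurable (measurableSet_singleton i)) (a := i * V / (n + 1))
    (b := (i + 1) * V / (n + 1)) ?_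
  · refine h.trans_eq (congrArg _ ?_)
    ring
  · intro x hx
    have hx' : min ⌊(n + 1) * ν.real (Iio x) / V⌋₊ n = i := hx
    have hn : (0 : ℝ) < n + 1 := by positivity
    have h0 : 0 ≤ (n + 1) * ν.real (Iio x) / V := by positivity
    constructor
    · have h1 : (i : ℝ) ≤ (n + 1) * ν.real (Iio x) / V := by
        have : i ≤ ⌊(n + 1) * ν.real (Iio x) / V⌋₊ := hx' ▸ min_le_left _ _
        exact (Nat.le_floor_iff h0).1 this
      rw [le_div_iff₀ hV] at h1
      rw [div_le_iff₀ hn]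
      linarith
    · rw [le_div_iff₀ hn]
      rcases le_total n ⌊(n + 1) * ν.real (Iio x) / V⌋₊ with h1 | h1
      · rw [min_eq_right h1] at hx'
        have h2 : ν.real (Iio x) ≤ V := measureReal_mono (subset_univ _)
        rw [← hx', mul_comm]
        gcongr
      · rw [min_eq_left h1] at hx'
        have h2 := (Nat.lt_floor_add_one ((n + 1) * ν.real (Iio x) / V)).le
        rw [hx', div_le_iff₀ hV] at h2
        linarith

/-- Weighted Volterra operators are approximated by operators of rank `n` up to an error of
order `1 / n`. -/
theorem exists_hasRankApprox_volterraOp [NullSingletonClass μ] (hw : Measurable w)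
    (hw2 : ∫⁻ y, ‖w y‖ₑ ^ 2 ∂μ < ∞) :
    ∃ C : ℝ, ∀ n : ℕ, HasRankApprox (volterraOp hw hw2) n (C * ((n : ℝ) + 1)⁻¹) := by
  -- Partitioning μ + w²μ into equal parts controls the μ-mass and the w²-mass of every cell
  -- simultaneously.
  let ρ : Measure ℝ := μ.withDensity fun y => ‖w y‖ₑ ^ 2
  have hρ : IsFiniteMeasure ρ := isFiniteMeasure_withDensity hw2.ne
  have hρ' : NullSingletonClass ρ := ⟨fun x => withDensity_absolutelyContinuous μ _ (measure_singleton x)⟩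
  have hνa : NullSingletonClass (μ + ρ) := ⟨fun x => by simp⟩
  refine ⟨(μ + ρ).real univ, fun n => ?_⟩
  obtain ⟨j, hj, hjn, hcell⟩ := exists_monotone_partition (μ + ρ) n
  rw [← div_eq_mul_inv]
  refine hasRankApprox_volterraOp_of_partition hw hw2 hj hjn (by positivity)
    (fun i => le_trans ?_ (hcell i)) (fun i => le_trans ?_ (hcell i))
  · rw [Measure.add_apply]
    exact le_self_add
  · rw [Measure.add_apply, withDensity_apply _ (hj.measurable (measurableSet_singleton i))]
    exact le_add_self

end Volterra

/-! ### The function `|tan (θ / 2)|` -/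

section HalfTan

open scoped ENNReal

/-- `|tan (θ / 2)|`, whose logarithmic derivative is `1 / sin θ`. -/
noncomputable def halfTan (θ : ℝ) : ℝ := |Real.tan (θ / 2)|

theorem halfTan_neg (θ : ℝ) : halfTan (-θ) = halfTan θ := by
  simp [halfTan, neg_div]

theorem halfTan_nonneg (θ : ℝ) : 0 ≤ halfTan θ := abs_nonneg _

theorem measurable_halfTan : Measurable halfTan := by
  have h : halfTan = fun θ => |Real.sin (θ / 2) / Real.cos (θ / 2)| := by
    funext θ
    rw [halfTan, Real.tan_eq_sin_div_cos]
  rw [h]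
  exact Measurable.abs (by fun_prop)

variable {θ : ℝ}

theorem cos_half_pos (h : |θ| < π) : 0 < Real.cos (θ / 2) := by
  rw [abs_lt] at h
  exact Real.cos_pos_of_mem_Ioo ⟨by linarith, by linarith⟩

theorem sin_half_ne_zero (h : |θ| < π) (h0 : θ ≠ 0) : Real.sin (θ / 2) ≠ 0 := by
  rw [abs_lt] at h
  have hpi := Real.pi_pos
  intro hs
  rw [Real.sin_eq_zero_iff_of_lt_of_lt (by linarith) (by linarith)] at hs
  exact h0 (by linarith)

theorem sin_eq_two_mul_half (θ : ℝ) : Real.sin θ = 2 * Real.sin (θ / 2) * Real.cos (θ / 2) := by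
  rw [← Real.sin_two_mul]
  ring_nf

theorem sin_ne_zero_of_abs_lt (h : |θ| < π) (h0 : θ ≠ 0) : Real.sin θ ≠ 0 := by
  rw [sin_eq_two_mul_half]
  have := (cos_half_pos h).ne'
  have := sin_half_ne_zero h h0
  positivity

theorem halfTan_pos (h : |θ| < π) (h0 : θ ≠ 0) : 0 < halfTan θ := by
  rw [halfTan, abs_pos, Real.tan_eq_sin_div_cos]
  exact div_ne_zero (sin_half_ne_zero h h0) (cos_half_pos h).ne'

theorem continuousAt_halfTan (h : |θ| < π) : ContinuousAt halfTan θ := by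
  have h1 : ContinuousAt Real.tan (θ / 2) := Real.continuousAt_tan.2 (cos_half_pos h).ne'
  exact (ContinuousAt.comp (f := fun x : ℝ => x / 2) h1 (by fun_prop)).abs

theorem hasDerivAt_halfTan (h : |θ| < π) (h0 : θ ≠ 0) :
    HasDerivAt halfTan (halfTan θ / Real.sin θ) θ := by
  have hc := (cos_half_pos h).ne'
  have hs := sin_half_ne_zero h h0
  have ht : Real.tan (θ / 2) ≠ 0 := by
    rw [Real.tan_eq_sin_div_cos]
    exact div_ne_zero hs hc
  have h1 : HasDerivAt (fun x : ℝ => Real.tan (x / 2)) (1 / Real.cos (θ / 2) ^ 2 * (1 / 2)) θ :=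
    HasDerivAt.comp (h := fun x : ℝ => x / 2) θ (Real.hasDerivAt_tan hc)
      ((hasDerivAt_id θ).div_const 2)
  have h2 := (hasDerivAt_abs ht).comp θ h1
  refine h2.congr_deriv ?_
  have h3 : halfTan θ = SignType.sign (Real.tan (θ / 2)) * Real.tan (θ / 2) :=
    (sign_mul_self _).symm
  rw [h3, sin_eq_two_mul_half, mul_div_assoc, Real.tan_eq_sin_div_cos]
  congr 1
  field_simp

theorem hasDerivAt_halfTan_rpow (h : |θ| < π) (h0 : θ ≠ 0) (γ : ℝ) :
    HasDerivAt (fun x => halfTan x ^ γ) (γ * halfTan θ ^ γ / Real.sin θ) θ := by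
  have hp := halfTan_pos h h0
  refine ((hasDerivAt_halfTan h h0).rpow_const (p := γ) (Or.inl hp.ne')).congr_deriv ?_
  rw [Real.rpow_sub_one hp.ne']
  field_simp

theorem contDiffAt_halfTan_rpow (h : |θ| < π) (h0 : θ ≠ 0) (γ : ℝ) :
    ContDiffAt ℝ 1 (fun x => halfTan x ^ γ) θ := by
  have hc := (cos_half_pos h).ne'
  have ht : Real.tan (θ / 2) ≠ 0 := abs_pos.1 (halfTan_pos h h0)
  have h1 : ContDiffAt ℝ 1 (fun x : ℝ => Real.tan (x / 2)) θ :=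
    ContDiffAt.comp (g := Real.tan) (f := fun x : ℝ => x / 2) θ (Real.contDiffAt_tan.2 hc)
      (contDiffAt_id.div_const (2 : ℝ))
  exact (h1.abs ht).rpow_const_of_ne (halfTan_pos h h0).ne'

/-- (t^γ sin)' = t^γ (γ + cos) ≥ (γ - 1) t^γ, and t^γ sin vanishes at 0. -/
theorem integral_halfTan_rpow_le {γ : ℝ} (hγ : 1 < γ) (h0 : 0 < θ) (h : θ < π) :
    IntegrableOn (fun s => halfTan s ^ γ) (Icc 0 θ) ∧
    ∫ s in 0..θ, halfTan s ^ γ ≤ halfTan θ ^ γ * Real.sin θ / (γ - 1) := by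
  have hmem : ∀ x ∈ Icc 0 θ, |x| < π := fun x hx => by
    rw [abs_of_nonneg hx.1]
    exact hx.2.trans_lt h
  have hcont : ContinuousOn (fun s => halfTan s ^ γ) (Icc 0 θ) := fun x hx =>
    ((continuousAt_halfTan (hmem x hx)).rpow_const (Or.inr (by linarith))).continuousWithinAt
  refine ⟨hcont.integrableOn_Icc, ?_⟩
  have key := intervalIntegral.integral_le_sub_of_hasDeriv_right_of_le
    (g := fun s => halfTan s ^ γ * Real.sin s / (γ - 1)) (φ := fun s => halfTan s ^ γ)
    (g' := fun s => (γ * halfTan s ^ γ / Real.sin s * Real.sin s + halfTan s ^ γ * Real.cos s) /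
      (γ - 1)) h0.le ((hcont.mul Real.continuous_sin.continuousOn).div_const _)
    (fun x hx => ?_) hcont.integrableOn_Icc (fun x hx => ?_)
  · simpa using key
  · exact (((hasDerivAt_halfTan_rpow (hmem x (Ioo_subset_Icc_self hx)) hx.1.ne' γ).mul
      (Real.hasDerivAt_sin x)).div_const _).hasDerivWithinAt
  · have hs : Real.sin x ≠ 0 :=
      sin_ne_zero_of_abs_lt (hmem x (Ioo_subset_Icc_self hx)) hx.1.ne'
    have hp : 0 ≤ halfTan x ^ γ := Real.rpow_nonneg (halfTan_nonneg x) γ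
    have hγ' : 0 < γ - 1 := by linarith
    rw [le_div_iff₀ hγ', div_mul_cancel₀ _ hs]
    nlinarith [Real.neg_one_le_cos x]

theorem integral_halfTan_rpow_neg_div_sin_le {b : ℝ} (hb : 0 < b) {s : ℝ} (h0 : 0 < s)
    (h : s < π) : IntegrableOn (fun x => halfTan x ^ (-b) / Real.sin x) (Ioc s π) ∧
    ∫ x in s..π, halfTan x ^ (-b) / Real.sin x = halfTan s ^ (-b) / b := by
  -- This is the antiderivative -t^(-b)/b written with the cotangent, which is continuous up to π
  -- and vanishes there.
  let g : ℝ → ℝ := fun x => -((Real.cos (x / 2) / Real.sin (x / 2)) ^ b / b)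
  have hsin : ∀ x ∈ Icc s π, 0 < Real.sin (x / 2) := fun x hx =>
    Real.sin_pos_of_pos_of_lt_pi (by linarith [hx.1]) (by linarith [hx.2, Real.pi_pos])
  have hg : ∀ x, 0 < x → x < π → g x = -(halfTan x ^ (-b) / b) := by
    intro x hx hx'
    have hx2 : |x| < π := by rwa [abs_of_pos hx]
    have hs : 0 < Real.sin (x / 2) :=
      Real.sin_pos_of_pos_of_lt_pi (by linarith) (by linarith [Real.pi_pos])
    have hc := cos_half_pos hx2
    have : halfTan x = Real.sin (x / 2) / Real.cos (x / 2) := by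
      rw [halfTan, Real.tan_eq_sin_div_cos, abs_of_pos (by positivity)]
    simp only [g]
    rw [this, Real.rpow_neg (by positivity), ← Real.inv_rpow (by positivity), inv_div]
  have hcont : ContinuousOn g (Icc s π) := by
    refine ContinuousOn.neg (ContinuousOn.div_const (ContinuousOn.rpow_const ?_ ?_) b)
    · exact ContinuousOn.div (by fun_prop) (by fun_prop) fun x hx => (hsin x hx).ne'
    · exact fun x _ => Or.inr hb.le
  have hderiv : ∀ x ∈ Ioo s π, HasDerivAt g (halfTan x ^ (-b) / Real.sin x) x := by
    intro x hx
    have hx0 : 0 < x := h0.trans hx.1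
    have h1 := ((hasDerivAt_halfTan_rpow (by rw [abs_of_pos hx0]; exact hx.2) hx0.ne'
      (-b)).div_const b).neg
    refine (h1.congr_of_eventuallyEq ?_).congr_deriv ?_
    · filter_upwards [isOpen_Ioo.mem_nhds (show x ∈ Ioo 0 π from ⟨hx0, hx.2⟩)] with y hy
      exact hg y hy.1 hy.2
    · field_simp
  -- Integrability up to π is not assumed: it follows because the derivative is nonnegative and the
  -- antiderivative is continuous on the closed interval.
  have hint := intervalIntegral.integrableOn_deriv_of_nonneg hcont hderiv fun x hx =>
    div_nonneg (Real.rpow_nonneg (halfTan_nonneg x) _)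
      (Real.sin_pos_of_pos_of_lt_pi (h0.trans hx.1) hx.2).le
  refine ⟨hint, ?_⟩
  rw [intervalIntegral.integral_eq_sub_of_hasDerivAt_of_le h.le hcont hderiv
    ((intervalIntegrable_iff_integrableOn_Ioc_of_le h.le).2 hint), hg s h0 h]
  simp [g, Real.cos_pi_div_two, Real.zero_rpow hb.ne']

/-- `s` lies strictly between `0` and `θ`. -/
def LiesInside (s θ : ℝ) : Prop := 0 < s ∧ s < θ ∨ θ < s ∧ s < 0

theorem liesInside_neg_neg {s θ : ℝ} : LiesInside (-s) (-θ) ↔ LiesInside s θ := by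
  simp only [LiesInside, neg_pos, neg_lt_neg_iff, neg_lt_zero]
  tauto

theorem liesInside_iff_of_pos {s θ : ℝ} (h : 0 < θ) : LiesInside s θ ↔ s ∈ Ioo 0 θ := by
  refine ⟨?_, Or.inl⟩
  rintro (h' | h')
  · exact h'
  · linarith [h'.1, h'.2]

theorem liesInside_iff_of_neg {s θ : ℝ} (h : θ < 0) : LiesInside s θ ↔ s ∈ Ioo θ 0 := by
  refine ⟨?_, Or.inr⟩
  rintro (h' | h')
  · linarith [h'.1, h'.2]
  · exact h'

theorem liesInside_iff_of_pos_left {s θ : ℝ} (h : 0 < s) : LiesInside s θ ↔ s < θ := by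
  refine ⟨?_, fun h' => Or.inl ⟨h, h'⟩⟩
  rintro (h' | h')
  · exact h'.2
  · linarith [h'.1, h'.2]

theorem measurableSet_liesInside : MeasurableSet {p : ℝ × ℝ | LiesInside p.2 p.1} :=
  ((measurableSet_lt measurable_const measurable_snd).inter
    (measurableSet_lt measurable_snd measurable_fst)).union
  ((measurableSet_lt measurable_fst measurable_snd).inter
    (measurableSet_lt measurable_snd measurable_const))

-- The inner integral in s of the kernel estimates, for either sign of θ.
open scoped Classical in
theorem lintegral_liesInside_halfTan_rpow_le {γ : ℝ} (hγ : 1 < γ) (h : |θ| < π) (h0 : θ ≠ 0) :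
    ∫⁻ s, (if LiesInside s θ then ENNReal.ofReal (halfTan s ^ γ) else 0) ≤
      ENNReal.ofReal (halfTan θ ^ γ * |Real.sin θ| / (γ - 1)) := by
  wlog hpos : 0 < θ generalizing θ
  · have h1 := this (θ := -θ) (by rwa [abs_neg]) (neg_ne_zero.2 h0)
      (neg_pos.2 (lt_of_le_of_ne (not_lt.1 hpos) h0))
    rw [halfTan_neg, Real.sin_neg, abs_neg, ← lintegral_neg_eq_self] at h1
    simpa only [liesInside_neg_neg, halfTan_neg] using h1
  rw [abs_of_pos hpos] at h
  obtain ⟨h1, h2⟩ := integral_halfTan_rpow_le hγ hpos h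
  have h3 : (fun s => if LiesInside s θ then ENNReal.ofReal (halfTan s ^ γ) else 0) =
      (Ioo 0 θ).indicator fun s => ENNReal.ofReal (halfTan s ^ γ) := by
    funext s
    simp only [liesInside_iff_of_pos hpos, indicator_apply]
  rw [h3, lintegral_indicator measurableSet_Ioo, ← ofReal_integral_eq_lintegral_ofReal
    (h1.mono_set Ioo_subset_Icc_self)
    (Eventually.of_forall fun s => Real.rpow_nonneg (halfTan_nonneg s) γ),
    ← integral_Ioc_eq_integral_Ioo, ← intervalIntegral.integral_of_le hpos.le,
    abs_of_pos (Real.sin_pos_of_pos_of_lt_pi hpos h)]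
  exact ENNReal.ofReal_le_ofReal h2

-- The matching integral in θ, used after Tonelli in the Hardy inequality; the condition |θ| < π
-- keeps it inside the domain.
open scoped Classical in
theorem lintegral_liesInside_halfTan_rpow_neg_le {b : ℝ} (hb : 0 < b) {s : ℝ} (h : |s| < π)
    (h0 : s ≠ 0) :
    ∫⁻ θ, (if LiesInside s θ ∧ |θ| < π then ENNReal.ofReal (halfTan θ ^ (-b) / |Real.sin θ|) else 0) ≤
      ENNReal.ofReal (halfTan s ^ (-b) / b) := by
  wlog hpos : 0 < s generalizing s
  · have h1 := this (s := -s) (by rwa [abs_neg]) (neg_ne_zero.2 h0)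
      (neg_pos.2 (lt_of_le_of_ne (not_lt.1 hpos) h0))
    rw [halfTan_neg, ← lintegral_neg_eq_self] at h1
    simpa only [liesInside_neg_neg, halfTan_neg, Real.sin_neg, abs_neg] using h1
  rw [abs_of_pos hpos] at h
  obtain ⟨h1, h2⟩ := integral_halfTan_rpow_neg_div_sin_le hb hpos h
  have h3 : (fun θ => if LiesInside s θ ∧ |θ| < π then
      ENNReal.ofReal (halfTan θ ^ (-b) / |Real.sin θ|) else 0) =
      (Ioo s π).indicator fun θ => ENNReal.ofReal (halfTan θ ^ (-b) / Real.sin θ) := by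
    funext θ
    have h4 : (LiesInside s θ ∧ |θ| < π) ↔ θ ∈ Ioo s π := by
      rw [liesInside_iff_of_pos_left hpos, mem_Ioo, and_congr_right_iff]
      intro h5
      rw [abs_of_pos (hpos.trans h5)]
    simp only [h4, indicator_apply]
    split_ifs with h5
    · rw [abs_of_pos (Real.sin_pos_of_pos_of_lt_pi (hpos.trans h5.1) h5.2)]
    · rfl
  rw [h3, lintegral_indicator measurableSet_Ioo, ← ofReal_integral_eq_lintegral_ofReal
    (h1.mono_set Ioo_subset_Ioc_self) ?_,
    ← integral_Ioc_eq_integral_Ioo, ← intervalIntegral.integral_of_le h.le, h2]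
  filter_upwards [ae_restrict_mem measurableSet_Ioo] with θ hθ
  exact div_nonneg (Real.rpow_nonneg (halfTan_nonneg θ) _)
    (Real.sin_pos_of_pos_of_lt_pi (hpos.trans hθ.1) hθ.2).le

theorem two_div_pi_mul_min_le_sin {x : ℝ} (h0 : 0 ≤ x) (h : x ≤ π) :
    2 / π * min x (π - x) ≤ Real.sin x := by
  have hpi := Real.pi_pos
  rcases le_total x (π / 2) with h1 | h1
  · rw [min_eq_left (by linarith)]
    exact Real.mul_le_sin h0 h1
  · rw [min_eq_right (by linarith), ← Real.sin_pi_sub]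
    exact Real.mul_le_sin (by linarith) (by linarith)

/-- The zeros of sin are simple, by Jordan's inequality. This one fact makes both the Volterra
weight |sin|^(-1/4) and the weighted solution kernel square integrable. -/
theorem integrableOn_abs_sin_rpow : IntegrableOn (fun x => |Real.sin x| ^ (-(1 / 2) : ℝ))
    (Ioo (-π) π) := by
  have hpi := Real.pi_pos
  have hm : Measurable fun x => |Real.sin x| ^ (-(1 / 2) : ℝ) :=
    (Real.measurable_sin.abs).pow_const _
  have h1 : IntegrableOn (fun x => |Real.sin x| ^ (-(1 / 2) : ℝ)) (Ioo 0 π) := by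
    have h2 : IntervalIntegrable (fun x : ℝ => x ^ (-(1 / 2) : ℝ)) volume 0 π :=
      intervalIntegral.intervalIntegrable_rpow' (by norm_num)
    have h3 : IntervalIntegrable (fun x : ℝ => (π - x) ^ (-(1 / 2) : ℝ)) volume 0 π := by
      have := h2.comp_sub_left π
      simpa using this.symm
    have h4 := (h2.add h3).const_mul ((2 / π) ^ (-(1 / 2) : ℝ))
    rw [intervalIntegrable_iff_integrableOn_Ioo_of_le hpi.le] at h4
    refine Integrable.mono' h4 hm.aestronglyMeasurable ?_
    filter_upwards [ae_restrict_mem measurableSet_Ioo] with x hx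
    have hx1 : 0 < x := hx.1
    have hx2 : 0 < π - x := sub_pos.2 hx.2
    have h5 := two_div_pi_mul_min_le_sin hx1.le hx.2.le
    have hmin : 0 < min x (π - x) := lt_min hx1 hx2
    rw [Real.norm_of_nonneg (by positivity), abs_of_pos (Real.sin_pos_of_pos_of_lt_pi hx1 hx.2)]
    refine (Real.rpow_le_rpow_of_nonpos (by positivity) h5 (by norm_num)).trans ?_
    rw [Real.mul_rpow (by positivity) hmin.le]
    refine mul_le_mul_of_nonneg_left ?_ (by positivity)
    rcases min_choice x (π - x) with h6 | h6
    · rw [h6]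
      exact le_add_of_nonneg_right (by positivity)
    · rw [h6]
      exact le_add_of_nonneg_left (by positivity)
  have h2 : IntegrableOn (fun x => |Real.sin x| ^ (-(1 / 2) : ℝ)) (Ioo (-π) 0) := by
    have := (h1.comp_neg)
    simpa using this
  have h3 : IntegrableOn (fun x => |Real.sin x| ^ (-(1 / 2) : ℝ)) (Ioc (-π) 0 ∪ Ioo 0 π) :=
    IntegrableOn.union (by rwa [integrableOn_Ioc_iff_integrableOn_Ioo]) h1
  rwa [Ioc_union_Ioo_eq_Ioo (by linarith) hpi] at h3

end HalfTan

/-! ### The kernel of the solution operator -/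

section SolutionKernel

open scoped ENNReal

open scoped Classical in
/-- The kernel of the operator taking `f` to the solution `g` of
`((sin θ) g)' + β g = β f` with `(sin θ) g → 0` at `0`. -/
noncomputable def solKernel (β θ s : ℝ) : ℝ :=
  if LiesInside s θ then β * halfTan s ^ β * (halfTan θ ^ (-β) / |Real.sin θ|) else 0

theorem measurable_solKernel (β : ℝ) : Measurable (Function.uncurry (solKernel β)) := by
  classical
  have h1 : Measurable fun p : ℝ × ℝ =>
      β * halfTan p.2 ^ β * (halfTan p.1 ^ (-β) / |Real.sin p.1|) :=
    (((measurable_halfTan.comp measurable_snd).pow_const β).const_mul β).mul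
      (((measurable_halfTan.comp measurable_fst).pow_const (-β)).div
        (Real.measurable_sin.comp measurable_fst).abs)
  exact Measurable.ite measurableSet_liesInside h1 measurable_const

theorem ae_abs_lt_pi_and_ne_zero : ∀ᵐ θ ∂circVol, |θ| < π ∧ θ ≠ 0 := by
  filter_upwards [ae_restrict_mem measurableSet_Ioo,
    ae_restrict_of_ae (Measure.ae_ne volume (0 : ℝ))] with θ h1 h2
  exact ⟨abs_lt.2 h1, h2⟩

variable {β : ℝ} (hβ : 1 / 2 < β)
include hβ

/-- `lintegral_liesInside_halfTan_rpow_le` with γ = 2β, where β > 1/2 is exactly γ > 1; the powers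
of `halfTan θ` cancel. -/
theorem lintegral_solKernel_sq_le {θ : ℝ} (h : |θ| < π) (h0 : θ ≠ 0) :
    ∫⁻ s, ‖solKernel β θ s‖ₑ ^ 2 ∂circVol ≤
      ENNReal.ofReal (β ^ 2 / ((2 * β - 1) * |Real.sin θ|)) := by
  classical
  have hs : 0 < |Real.sin θ| := abs_pos.2 (sin_ne_zero_of_abs_lt h h0)
  have ht := halfTan_pos h h0
  have hβ' : 0 < 2 * β - 1 := by linarith
  have h1 : ∀ s, ‖solKernel β θ s‖ₑ ^ 2 =
      ENNReal.ofReal ((β * (halfTan θ ^ (-β) / |Real.sin θ|)) ^ 2) *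
        if LiesInside s θ then ENNReal.ofReal (halfTan s ^ (2 * β)) else 0 := by
    intro s
    rw [solKernel]
    split_ifs with hi
    · have hn : 0 ≤ halfTan s ^ β := Real.rpow_nonneg (halfTan_nonneg s) β
      rw [Real.enorm_of_nonneg (by positivity), ← ENNReal.ofReal_pow (by positivity),
        ← ENNReal.ofReal_mul (by positivity), mul_comm 2 β, Real.rpow_mul (halfTan_nonneg s),
        Real.rpow_two]
      congr 1
      ring
    · simp
  simp only [h1]
  refine (lintegral_mono' Measure.restrict_le_self le_rfl).trans ?_
  rw [lintegral_const_mul' _ _ ENNReal.ofReal_ne_top]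
  refine (mul_le_mul' le_rfl (lintegral_liesInside_halfTan_rpow_le (by linarith) h h0)).trans_eq ?_
  rw [← ENNReal.ofReal_mul (by positivity)]
  congr 1
  rw [Real.rpow_neg ht.le, mul_comm 2 β, Real.rpow_mul ht.le, Real.rpow_two]
  have := Real.rpow_pos_of_pos ht β
  field_simp

/-- The row bound 1/|sin θ| is not integrable. The factor |sin θ|^(1/4), squared, turns it into |sin
θ|^(-1/2), which is; the Volterra weight undoes this factor. -/
theorem isHSKernel_sin_mul_solKernel :
    IsHSKernel circVol fun θ s => |Real.sin θ| ^ (1 / 4 : ℝ) * solKernel β θ s := by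
  have hβ' : 0 < 2 * β - 1 := by linarith
  refine ⟨((Real.measurable_sin.comp measurable_fst).abs.pow_const _).mul
    (measurable_solKernel β), ?_⟩
  have h1 : ∀ᵐ θ ∂circVol, ∫⁻ s, ‖|Real.sin θ| ^ (1 / 4 : ℝ) * solKernel β θ s‖ₑ ^ 2 ∂circVol ≤
      ENNReal.ofReal (β ^ 2 / (2 * β - 1) * |Real.sin θ| ^ (-(1 / 2) : ℝ)) := by
    filter_upwards [ae_abs_lt_pi_and_ne_zero] with θ hθ
    have hs : 0 < |Real.sin θ| := abs_pos.2 (sin_ne_zero_of_abs_lt hθ.1 hθ.2)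
    simp only [enorm_mul, mul_pow]
    rw [lintegral_const_mul' _ _ (ENNReal.pow_ne_top enorm_ne_top)]
    refine (mul_le_mul' le_rfl (lintegral_solKernel_sq_le hβ hθ.1 hθ.2)).trans_eq ?_
    rw [Real.enorm_of_nonneg (by positivity), ← ENNReal.ofReal_pow (by positivity),
      ← ENNReal.ofReal_mul (by positivity), ← Real.rpow_two, ← Real.rpow_mul (by positivity)]
    congr 1
    have : |Real.sin θ| ^ (-(1 / 2) : ℝ) = |Real.sin θ| ^ (1 / 4 * 2 : ℝ) / |Real.sin θ| := by
      rw [← Real.rpow_sub_one hs.ne']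
      norm_num
    rw [this]
    field_simp
  refine (lintegral_mono_ae h1).trans_lt ?_
  exact (Integrable.const_mul integrableOn_abs_sin_rpow _).lintegral_lt_top

omit hβ in
theorem measurable_abs_sin_rpow : Measurable fun s => |Real.sin s| ^ (-(1 / 4) : ℝ) :=
  Real.measurable_sin.abs.pow_const _

omit hβ in
theorem lintegral_abs_sin_rpow_sq_lt_top :
    ∫⁻ s, ‖|Real.sin s| ^ (-(1 / 4) : ℝ)‖ₑ ^ 2 ∂circVol < ∞ := by
  refine lt_of_le_of_lt (lintegral_mono fun s => ?_) integrableOn_abs_sin_rpow.lintegral_lt_top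
  rw [Real.enorm_of_nonneg (by positivity), ← ENNReal.ofReal_pow (by positivity), ← Real.rpow_two,
    ← Real.rpow_mul (by positivity)]
  norm_num

/-- Schur test, first half: Cauchy–Schwarz after the splitting t^β = t^(β - b/2) · t^(b/2). The
condition b < 2β - 1 makes the exponent 2β - b of the first squared factor larger than 1. -/
theorem enorm_integral_solKernel_sq_le {b : ℝ} (hb' : b < 2 * β - 1) (f : L2Circ)
    {θ : ℝ} (h : |θ| < π) (h0 : θ ≠ 0) :
    ‖∫ s, (solKernel β θ s : ℂ) * f s ∂circVol‖ₑ ^ 2 ≤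
      ENNReal.ofReal (β ^ 2 / (2 * β - b - 1) * (halfTan θ ^ (-b) / |Real.sin θ|)) *
        ∫⁻ s, {s | LiesInside s θ}.indicator (fun s => ENNReal.ofReal (halfTan s ^ b)) s *
          ‖f s‖ₑ ^ 2 ∂circVol := by
  classical
  have hs : 0 < |Real.sin θ| := abs_pos.2 (sin_ne_zero_of_abs_lt h h0)
  have ht := halfTan_pos h h0
  have hβ' : 0 < 2 * β - b - 1 := by linarith
  have hJ : MeasurableSet {s | LiesInside s θ} := measurable_prodMk_left measurableSet_liesInside
  have hpm : ∀ γ : ℝ, Measurable fun s => ENNReal.ofReal (halfTan s ^ γ) := fun γ =>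
    (measurable_halfTan.pow_const γ).ennreal_ofReal
  set c : ℝ := β * (halfTan θ ^ (-β) / |Real.sin θ|) with hc
  have hc0 : 0 ≤ c := by positivity
  have h1 : ‖∫ s, (solKernel β θ s : ℂ) * f s ∂circVol‖ₑ ≤
      ∫⁻ s, (ENNReal.ofReal c * {s | LiesInside s θ}.indicator
        (fun s => ENNReal.ofReal (halfTan s ^ (β - b / 2))) s) *
        ({s | LiesInside s θ}.indicator (fun s => ENNReal.ofReal (halfTan s ^ (b / 2))) s *
          ‖f s‖ₑ) ∂circVol := by
    refine (enorm_integral_le_lintegral_enorm _).trans (lintegral_mono_ae ?_)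
    filter_upwards [ae_abs_lt_pi_and_ne_zero] with s hsm
    rw [enorm_mul, enorm_complex_ofReal, solKernel]
    by_cases hi : LiesInside s θ
    · have hmem : s ∈ {s | LiesInside s θ} := hi
      have htp := halfTan_pos hsm.1 hsm.2
      rw [if_pos hi, indicator_of_mem hmem, indicator_of_mem hmem, ← mul_assoc,
        Real.enorm_of_nonneg (by positivity), ← ENNReal.ofReal_mul hc0,
        ← ENNReal.ofReal_mul (by positivity), mul_assoc c, ← Real.rpow_add htp, hc]
      refine le_of_eq ?_
      congr 2
      ring_nf
    · rw [if_neg hi]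
      simp
  refine (pow_le_pow_left₀ zero_le h1 2).trans ?_
  refine (sq_lintegral_mul_le (((hpm _).indicator hJ).const_mul _).aemeasurable
    (((hpm _).indicator hJ).aemeasurable.mul (Lp.aestronglyMeasurable f).enorm)).trans ?_
  refine mul_le_mul' ?_ (lintegral_mono_ae ?_)
  · have h2 : ∀ s, (ENNReal.ofReal c * {s | LiesInside s θ}.indicator
        (fun s => ENNReal.ofReal (halfTan s ^ (β - b / 2))) s) ^ 2 = ENNReal.ofReal (c ^ 2) *
        if LiesInside s θ then ENNReal.ofReal (halfTan s ^ (2 * β - b)) else 0 := by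
      intro s
      rw [mul_pow, ENNReal.ofReal_pow hc0]
      congr 1
      by_cases hi : LiesInside s θ
      · have hmem : s ∈ {s | LiesInside s θ} := hi
        rw [if_pos hi, indicator_of_mem hmem,
          ← ENNReal.ofReal_pow (Real.rpow_nonneg (halfTan_nonneg s) _), ← Real.rpow_two,
          ← Real.rpow_mul (halfTan_nonneg s)]
        ring_nf
      · have hmem : s ∉ {s | LiesInside s θ} := hi
        rw [if_neg hi, indicator_of_notMem hmem, zero_pow two_ne_zero]
    simp only [h2]
    refine (lintegral_mono' Measure.restrict_le_self le_rfl).trans ?_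
    rw [lintegral_const_mul' _ _ ENNReal.ofReal_ne_top]
    refine (mul_le_mul' le_rfl
      (lintegral_liesInside_halfTan_rpow_le (by linarith) h h0)).trans_eq ?_
    rw [← ENNReal.ofReal_mul (by positivity)]
    congr 1
    have h3 : halfTan θ ^ (2 * β - b) = (halfTan θ ^ β) ^ 2 * halfTan θ ^ (-b) := by
      rw [← Real.rpow_two, ← Real.rpow_mul ht.le, ← Real.rpow_add ht]
      ring_nf
    rw [h3, hc, Real.rpow_neg ht.le β]
    have := Real.rpow_pos_of_pos ht β
    field_simp
  · filter_upwards with s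
    rw [Pi.mul_apply, mul_pow]
    refine mul_le_mul' (le_of_eq ?_) le_rfl
    by_cases hi : LiesInside s θ
    · have hmem : s ∈ {s | LiesInside s θ} := hi
      rw [indicator_of_mem hmem, indicator_of_mem hmem,
        ← ENNReal.ofReal_pow (Real.rpow_nonneg (halfTan_nonneg s) _), ← Real.rpow_two,
        ← Real.rpow_mul (halfTan_nonneg s)]
      ring_nf
    · have hmem : s ∉ {s | LiesInside s θ} := hi
      rw [indicator_of_notMem hmem, indicator_of_notMem hmem, zero_pow two_ne_zero]

/-- The solution operator is bounded in `L²`: a weighted Hardy inequality. -/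
theorem lintegral_enorm_integral_solKernel_sq_lt_top (f : L2Circ) :
    ∫⁻ θ, ‖∫ s, (solKernel β θ s : ℂ) * f s ∂circVol‖ₑ ^ 2 ∂circVol < ∞ := by
  classical
  -- b < 2β - 1 serves the integral in s, b > 0 the integral in θ.
  obtain ⟨b, hb, hb'⟩ : ∃ b : ℝ, 0 < b ∧ b < 2 * β - 1 := exists_between (by linarith)
  set K : ℝ := β ^ 2 / (2 * β - b - 1)
  have hK : 0 ≤ K := div_nonneg (sq_nonneg β) (by linarith)
  have hpm : Measurable fun θ => ENNReal.ofReal (halfTan θ ^ (-b) / |Real.sin θ|) :=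
    ((measurable_halfTan.pow_const _).div Real.measurable_sin.abs).ennreal_ofReal
  let F : ℝ → ℝ → ℝ≥0∞ := fun θ s => (if LiesInside s θ ∧ |θ| < π then
    ENNReal.ofReal (halfTan θ ^ (-b) / |Real.sin θ|) else 0) *
      (ENNReal.ofReal (halfTan s ^ b) * ‖f s‖ₑ ^ 2)
  have h1 : ∀ᵐ θ ∂circVol, ‖∫ s, (solKernel β θ s : ℂ) * f s ∂circVol‖ₑ ^ 2 ≤
      ENNReal.ofReal K * ∫⁻ s, F θ s ∂circVol := by
    filter_upwards [ae_abs_lt_pi_and_ne_zero] with θ hθ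
    refine (enorm_integral_solKernel_sq_le hβ hb' f hθ.1 hθ.2).trans_eq ?_
    rw [ENNReal.ofReal_mul hK, mul_assoc, ← lintegral_const_mul' _ _ ENNReal.ofReal_ne_top]
    congr 1
    refine lintegral_congr fun s => ?_
    by_cases hi : LiesInside s θ
    · have hmem : s ∈ {s | LiesInside s θ} := hi
      simp only [F]
      rw [indicator_of_mem hmem, if_pos ⟨hi, hθ.1⟩]
    · have hmem : s ∉ {s | LiesInside s θ} := hi
      simp [F, hi]
  refine (lintegral_mono_ae h1).trans_lt ?_
  rw [lintegral_const_mul' _ _ ENNReal.ofReal_ne_top]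
  refine ENNReal.mul_lt_top ENNReal.ofReal_lt_top ?_
  have hF : AEMeasurable (Function.uncurry F) (circVol.prod circVol) := by
    have hset : MeasurableSet {p : ℝ × ℝ | LiesInside p.2 p.1 ∧ |p.1| < π} :=
      measurableSet_liesInside.inter (measurableSet_lt measurable_fst.abs measurable_const)
    refine AEMeasurable.fun_mul ?_ (AEMeasurable.fun_mul ?_ ?_)
    · exact (Measurable.ite hset (hpm.comp measurable_fst) measurable_const).aemeasurable
    · exact (((measurable_halfTan.comp measurable_snd).pow_const b).ennreal_ofReal).aemeasurable
    · exact ((Lp.aestronglyMeasurable f).enorm.pow_const 2).comp_snd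
  rw [lintegral_lintegral_swap hF]
  -- Integrating t(θ)^(-b)/|sin θ| beyond s gives at most t(s)^(-b)/b, which cancels the weight
  -- t(s)^b.
  have h2 : ∀ᵐ s ∂circVol, ∫⁻ θ, F θ s ∂circVol ≤ ENNReal.ofReal b⁻¹ * ‖f s‖ₑ ^ 2 := by
    filter_upwards [ae_abs_lt_pi_and_ne_zero] with s hs
    have ht := halfTan_pos hs.1 hs.2
    simp only [F]
    rw [lintegral_mul_const' _ _ (ENNReal.mul_ne_top ENNReal.ofReal_ne_top
      (ENNReal.pow_ne_top enorm_ne_top)), ← mul_assoc]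
    refine mul_le_mul' ?_ le_rfl
    refine (mul_le_mul' ((lintegral_mono' Measure.restrict_le_self le_rfl).trans
      (lintegral_liesInside_halfTan_rpow_neg_le hb hs.1 hs.2)) le_rfl).trans_eq ?_
    rw [← ENNReal.ofReal_mul (by positivity)]
    congr 1
    rw [Real.rpow_neg ht.le]
    have := Real.rpow_pos_of_pos ht b
    field_simp
  refine (lintegral_mono_ae h2).trans_lt ?_
  rw [lintegral_const_mul' _ _ ENNReal.ofReal_ne_top, lintegral_enorm_sq_eq]
  exact ENNReal.mul_lt_top ENNReal.ofReal_lt_top (ENNReal.pow_lt_top enorm_lt_top)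

theorem memLp_integral_solKernel (f : L2Circ) :
    MemLp (fun θ => ∫ s, (solKernel β θ s : ℂ) * f s ∂circVol) 2 circVol :=
  memLp_two_of_lintegral_enorm_sq_lt_top
    (aestronglyMeasurable_integral_kernel (measurable_solKernel β) f)
    (lintegral_enorm_integral_solKernel_sq_lt_top hβ f)

end SolutionKernel

/-! ### Absolutely continuous primitives -/

section Primitive

/-- Increments of the primitive are dominated by those of the real primitive of ‖f‖. -/
theorem IntervalIntegrable.absolutelyContinuousOnInterval_integral {E : Type*}
    [NormedAddCommGroup E] [NormedSpace ℝ E] {f : ℝ → E} {a b c : ℝ}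
    (h : IntervalIntegrable f volume a b) (hc : c ∈ uIcc a b) :
    AbsolutelyContinuousOnInterval (fun x => ∫ s in c..x, f s) a b := by
  refine squeeze_zero' (Eventually.of_forall fun E => Finset.sum_nonneg fun i _ => dist_nonneg) ?_
    (h.norm.absolutelyContinuousOnInterval_intervalIntegral hc)
  have hmem : AbsolutelyContinuousOnInterval.disjWithin a b ∈
      AbsolutelyContinuousOnInterval.totalLengthFilter ⊓
        𝓟 (AbsolutelyContinuousOnInterval.disjWithin a b) :=
    mem_inf_of_right (mem_principal_self _)
  filter_upwards [hmem] with E hE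
  refine Finset.sum_le_sum fun i hi => ?_
  obtain ⟨h1, h2⟩ := hE.1 i hi
  have hsub : ∀ {x y}, x ∈ uIcc a b → y ∈ uIcc a b → IntervalIntegrable f volume x y :=
    fun hx hy => h.mono_set (uIcc_subset_uIcc hx hy)
  rw [dist_comm, dist_eq_norm, dist_comm, Real.dist_eq,
    intervalIntegral.integral_interval_sub_left (hsub hc h2) (hsub hc h1),
    intervalIntegral.integral_interval_sub_left (hsub hc h2).norm (hsub hc h1).norm]
  exact intervalIntegral.norm_integral_le_abs_integral_norm

theorem absolutelyContinuousOnInterval_const {E : Type*} [NormedAddCommGroup E] (e : E)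
    (a b : ℝ) : AbsolutelyContinuousOnInterval (fun _ => e) a b := by
  simp only [AbsolutelyContinuousOnInterval, dist_self, Finset.sum_const_zero]
  exact tendsto_const_nhds

theorem intervalIntegrable_L2Circ (f : L2Circ) {a b : ℝ} (ha : |a| ≤ π) (hb : |b| ≤ π) :
    IntervalIntegrable f volume a b := by
  have hpi := Real.pi_pos
  have h : IntervalIntegrable f volume (-π) π := by
    rw [intervalIntegrable_iff_integrableOn_Ioo_of_le (by linarith)]
    exact integrable_L2Circ f
  refine h.mono_set (uIcc_subset_uIcc ?_ ?_) <;> rw [uIcc_of_le (by linarith)]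
  · exact abs_le.1 ha
  · exact abs_le.1 hb

theorem ae_of_ae_circVol {P : ℝ → Prop} (h : ∀ᵐ θ ∂circVol, P θ) : ∀ᵐ θ, |θ| < π → P θ := by
  rw [ae_restrict_iff' measurableSet_Ioo] at h
  filter_upwards [h] with θ h1 h2
  exact h1 (abs_lt.1 h2)

/-- Segments from t d to d stay away from 0 and ±π for either sign of d, so both sides of 0 are
treated together. -/
theorem abs_lt_pi_and_ne_zero_of_mem {t d x : ℝ} (ht : t ∈ Ioc (0 : ℝ) 1) (hd : |d| < π)
    (hd0 : d ≠ 0) (hx : x ∈ uIcc (t * d) d) : |x| < π ∧ x ≠ 0 := by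
  rcases lt_or_gt_of_ne hd0 with h | h
  · have h1 : d ≤ t * d := by nlinarith [ht.2]
    rw [uIcc_of_ge h1] at hx
    have h2 : t * d < 0 := mul_neg_of_pos_of_neg ht.1 h
    rw [abs_of_neg h] at hd
    have h3 : x < 0 := hx.2.trans_lt h2
    exact ⟨by rw [abs_of_neg h3]; linarith [hx.1], h3.ne⟩
  · have h1 : t * d ≤ d := by nlinarith [ht.2]
    rw [uIcc_of_le h1] at hx
    have h2 : 0 < t * d := mul_pos ht.1 h
    rw [abs_of_pos h] at hd
    have h3 : 0 < x := h2.trans_le hx.1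
    exact ⟨by rw [abs_of_pos h3]; linarith [hx.2], h3.ne'⟩

/-- A function with derivative zero almost everywhere that is absolutely continuous away from `0`
and tends to `0` at `0` vanishes. -/
theorem eq_zero_of_ae_hasDerivAt_zero {D : ℝ → ℂ} {d : ℝ} (hd : |d| < π) (hd0 : d ≠ 0)
    (hac : ∀ t ∈ Ioc (0 : ℝ) 1, AbsolutelyContinuousOnInterval D (t * d) d)
    (hder : ∀ᵐ x, |x| < π → x ≠ 0 → HasDerivAt D 0 x)
    (hlim : Tendsto (fun t => D (t * d)) (nhdsWithin 0 (Ioi 0)) (nhds 0)) : D d = 0 := by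
  -- D is constant on each segment from t d to d; the limit t → 0 then identifies the constant.
  have h1 : ∀ t ∈ Ioc (0 : ℝ) 1, D (t * d) = D d := by
    intro t ht
    obtain ⟨C, hC⟩ := (hac t ht).const_of_ae_hasDerivAt_zero (by
      filter_upwards [hder] with x hx hxm
      obtain ⟨h2, h3⟩ := abs_lt_pi_and_ne_zero_of_mem ht hd hd0 hxm
      exact hx h2 h3)
    rw [hC _ left_mem_uIcc, hC _ right_mem_uIcc]
  have h2 : Tendsto (fun t => D (t * d)) (nhdsWithin 0 (Ioi 0)) (nhds (D d)) := by
    refine tendsto_const_nhds.congr' ?_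
    filter_upwards [Ioc_mem_nhdsGT (zero_lt_one (α := ℝ))] with t ht
    exact (h1 t ht).symm
  exact tendsto_nhds_unique h2 hlim

theorem absolutelyContinuousOnInterval_halfTan_rpow {t d : ℝ} (ht : t ∈ Ioc (0 : ℝ) 1)
    (hd : |d| < π) (hd0 : d ≠ 0) (γ : ℝ) :
    AbsolutelyContinuousOnInterval (fun x => halfTan x ^ γ) (t * d) d := by
  refine ContDiffOn.absolutelyContinuousOnInterval fun x hx => ?_
  obtain ⟨h1, h2⟩ := abs_lt_pi_and_ne_zero_of_mem ht hd hd0 hx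
  exact (contDiffAt_halfTan_rpow h1 h2 γ).contDiffWithinAt

theorem uIcc_mul_subset {t d : ℝ} (ht : t ∈ Ioc (0 : ℝ) 1) (hd : |d| < π) (hd0 : d ≠ 0) :
    uIcc (t * d) d ⊆ uIcc (-π) π := by
  intro x hx
  have h := abs_lt.1 (abs_lt_pi_and_ne_zero_of_mem ht hd hd0 hx).1
  rw [uIcc_of_le (by linarith [h.1, h.2])]
  exact ⟨h.1.le, h.2.le⟩

theorem tendsto_mul_nhdsGT_zero (d : ℝ) :
    Tendsto (fun t : ℝ => t * d) (nhdsWithin 0 (Ioi 0)) (nhds 0) := by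
  have : Tendsto (fun t : ℝ => t * d) (nhds 0) (nhds (0 * d)) :=
    (continuous_mul_const d).tendsto 0
  rw [zero_mul] at this
  exact this.mono_left nhdsWithin_le_nhds

theorem continuousAt_zero_of_ac {v : ℝ → ℂ} (hv : AbsolutelyContinuousOnInterval v (-π) π) :
    ContinuousAt v 0 := by
  have hpi := Real.pi_pos
  have h := hv.continuousOn
  rw [uIcc_of_le (by linarith)] at h
  exact h.continuousAt (Icc_mem_nhds (by linarith) hpi)

end Primitive

/-! ### The first order equation -/

section FirstOrder

open scoped ENNReal

variable {β : ℝ} (f : L2Circ)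

/-- For θ < 0 the sign lost in |sin θ| is restored by the reversed orientation of the integral from
0 to θ. -/
theorem integral_solKernel_eq (β : ℝ) {θ : ℝ} (h : |θ| < π) (h0 : θ ≠ 0) :
    ∫ s, (solKernel β θ s : ℂ) * f s ∂circVol =
      ((β * halfTan θ ^ (-β) / Real.sin θ : ℝ) : ℂ) * ∫ s in 0..θ, halfTan s ^ β • f s := by
  classical
  have habs := abs_lt.1 h
  have hpi := Real.pi_pos
  have key : ∀ a b : ℝ, -π ≤ a → b ≤ π → (∀ s, LiesInside s θ ↔ s ∈ Ioo a b) →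
      ∫ s, (solKernel β θ s : ℂ) * f s ∂circVol =
        ((β * (halfTan θ ^ (-β) / |Real.sin θ|) : ℝ) : ℂ) *
          ∫ s in Ioo a b, halfTan s ^ β • f s := by
    intro a b ha hb hab
    have h1 : (fun s => (solKernel β θ s : ℂ) * f s) = (Ioo a b).indicator fun s =>
        ((β * (halfTan θ ^ (-β) / |Real.sin θ|) : ℝ) : ℂ) * (halfTan s ^ β • f s) := by
      funext s
      by_cases hs : s ∈ Ioo a b
      · rw [indicator_of_mem hs, solKernel, if_pos ((hab s).2 hs), Complex.real_smul]
        push_cast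
        ring
      · rw [indicator_of_notMem hs, solKernel, if_neg fun hi => hs ((hab s).1 hi)]
        simp
    rw [h1, integral_indicator measurableSet_Ioo, integral_const_mul,
      Measure.restrict_restrict measurableSet_Ioo,
      inter_eq_self_of_subset_left (Ioo_subset_Ioo ha hb)]
  rcases lt_or_gt_of_ne h0 with hneg | hpos
  · rw [key θ 0 habs.1.le hpi.le fun s => liesInside_iff_of_neg hneg,
      intervalIntegral.integral_of_ge hneg.le, integral_Ioc_eq_integral_Ioo,
      abs_of_neg (Real.sin_neg_of_neg_of_neg_pi_lt hneg habs.1)]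
    push_cast
    ring
  · rw [key 0 θ (by linarith) habs.2.le fun s => liesInside_iff_of_pos hpos,
      intervalIntegral.integral_of_le hpos.le, integral_Ioc_eq_integral_Ioo,
      abs_of_pos (Real.sin_pos_of_pos_of_lt_pi hpos habs.2)]
    push_cast
    ring

theorem intervalIntegrable_halfTan_rpow_smul (hβ : 0 ≤ β) {d : ℝ} (hd : |d| < π) :
    IntervalIntegrable (fun s => halfTan s ^ β • f s) volume 0 d := by
  refine (intervalIntegrable_L2Circ f (by simp [Real.pi_pos.le]) hd.le).continuousOn_smul ?_
  intro x hx
  have hx' : |x| < π := by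
    have := abs_sub_left_of_mem_uIcc hx
    simp only [sub_zero] at this
    exact this.trans_lt hd
  exact ((continuousAt_halfTan hx').rpow_const (Or.inr hβ)).continuousWithinAt

/-- Gives (sin θ) g = O(|sin θ|^(1/2)), hence the initial value 0 at θ = 0. -/
theorem norm_sin_mul_integral_solKernel_sq_le (hβ : 1 / 2 < β) {θ : ℝ} (h : |θ| < π)
    (h0 : θ ≠ 0) :
    ‖(Real.sin θ : ℂ) * ∫ s, (solKernel β θ s : ℂ) * f s ∂circVol‖ ^ 2 ≤
      β ^ 2 / (2 * β - 1) * |Real.sin θ| * ‖f‖ ^ 2 := by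
  have hs : 0 < |Real.sin θ| := abs_pos.2 (sin_ne_zero_of_abs_lt h h0)
  have hβ' : 0 < 2 * β - 1 := by linarith
  have h1 := (enorm_integral_mul_sq_le ((measurable_solKernel β).comp measurable_prodMk_left)
    f).trans (mul_le_mul' (lintegral_solKernel_sq_le hβ h h0) le_rfl)
  rw [lintegral_enorm_sq_eq, ← ofReal_norm, ← ofReal_norm,
    ← ENNReal.ofReal_pow (norm_nonneg _), ← ENNReal.ofReal_pow (norm_nonneg _),
    ← ENNReal.ofReal_mul (by positivity), ENNReal.ofReal_le_ofReal_iff (by positivity)] at h1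
  have h2 : ‖∫ s, (solKernel β θ s : ℂ) * f s ∂circVol‖ ^ 2 ≤
      β ^ 2 / ((2 * β - 1) * |Real.sin θ|) * ‖f‖ ^ 2 := h1
  rw [norm_mul, mul_pow, Complex.norm_real, Real.norm_eq_abs]
  refine (mul_le_mul_of_nonneg_left h2 (sq_nonneg _)).trans_eq ?_
  field_simp

/-- The solution `g` of the first order equation for the right hand side `f`. -/
noncomputable def solL2 (hβ : 1 / 2 < β) : L2Circ := (memLp_integral_solKernel hβ f).toLp _

theorem solL2_ae_eq (hβ : 1 / 2 < β) :
    solL2 f hβ =ᵐ[circVol] fun θ => ∫ s, (solKernel β θ s : ℂ) * f s ∂circVol :=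
  (memLp_integral_solKernel hβ f).coeFn_toLp

/-- `(sin θ) g` is the primitive of `β (f - g)` vanishing at `0`. -/
theorem integral_sub_solL2_eq (hβ : 1 / 2 < β) {d : ℝ} (hd : |d| < π) (hd0 : d ≠ 0) :
    ∫ s in 0..d, ((β : ℂ) • (f - solL2 f hβ) : L2Circ) s =
      (Real.sin d : ℂ) * ∫ s, (solKernel β d s : ℂ) * f s ∂circVol := by
  have hpi := Real.pi_pos
  set k : L2Circ := (β : ℂ) • (f - solL2 f hβ) with hk
  set v : ℝ → ℂ := fun x => ∫ s in 0..x, k s with hv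
  set W : ℝ → ℂ := fun x => ∫ s in 0..x, halfTan s ^ β • f s with hW
  -- u is the explicit form of (sin θ) g. It is compared with v, the primitive of β (f - g): both
  -- have the same derivative almost everywhere and tend to 0 at 0.
  let u : ℝ → ℂ := fun x => (β * halfTan x ^ (-β)) • W x
  have hu : ∀ x, |x| < π → x ≠ 0 →
      u x = (Real.sin x : ℂ) * ∫ s, (solKernel β x s : ℂ) * f s ∂circVol := by
    intro x hx hx0
    rw [integral_solKernel_eq f β hx hx0, ← mul_assoc, ← Complex.ofReal_mul,
      mul_div_cancel₀ _ (sin_ne_zero_of_abs_lt hx hx0)]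
    exact Complex.real_smul
  have hkint : IntervalIntegrable k volume (-π) π :=
    intervalIntegrable_L2Circ k (by simp [abs_of_pos hpi]) (abs_of_pos hpi).le
  have h0mem : (0 : ℝ) ∈ uIcc (-π) π := by
    rw [uIcc_of_le (by linarith)]
    exact ⟨by linarith, hpi.le⟩
  have hvac : AbsolutelyContinuousOnInterval v (-π) π :=
    hkint.absolutelyContinuousOnInterval_integral h0mem
  suffices hD : u d - v d = 0 by
    rw [← hu d hd hd0]
    exact (sub_eq_zero.1 hD).symm
  have hβ0 : 0 ≤ β := by linarith
  refine eq_zero_of_ae_hasDerivAt_zero (D := fun x => u x - v x) hd hd0 (fun t ht => ?_) ?_ ?_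
  · have h1 : AbsolutelyContinuousOnInterval W (t * d) d :=
      ((intervalIntegrable_halfTan_rpow_smul f hβ0 hd).absolutelyContinuousOnInterval_integral
        left_mem_uIcc).mono (uIcc_subset_uIcc (by
          rw [mem_uIcc]
          rcases lt_or_gt_of_ne hd0 with h | h
          · exact Or.inr ⟨by nlinarith [ht.2], by nlinarith [ht.1]⟩
          · exact Or.inl ⟨by nlinarith [ht.1], by nlinarith [ht.2]⟩) right_mem_uIcc)
    have h2 : AbsolutelyContinuousOnInterval (fun x => β * halfTan x ^ (-β)) (t * d) d :=
      (absolutelyContinuousOnInterval_halfTan_rpow ht hd hd0 (-β)).const_mul β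
    exact (h2.smul h1).sub (hvac.mono (uIcc_mul_subset ht hd hd0))
  · have hW' : ∀ᵐ x, |x| < π → HasDerivAt W (halfTan x ^ β • f x) x := by
      -- The weight t^β blows up at ±π, so W is differentiated on an exhaustion of (-π, π) by
      -- compact intervals.
      have h1 : ∀ n : ℕ, ∀ᵐ x, |x| < π - 1 / (n + 1) → HasDerivAt W (halfTan x ^ β • f x) x := by
        intro n
        rcases lt_or_ge (π - 1 / ((n : ℝ) + 1)) 0 with hneg | hnn
        · exact Eventually.of_forall fun x hx => absurd (abs_nonneg x) (not_le.2 (hx.trans hneg))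
        have hlt : |π - 1 / ((n : ℝ) + 1)| < π := by
          rw [abs_of_nonneg hnn]
          have : (0 : ℝ) < 1 / ((n : ℝ) + 1) := by positivity
          linarith
        have h2 := (intervalIntegrable_halfTan_rpow_smul f hβ0 hlt).ae_hasDerivAt_integral
        have h3 := (intervalIntegrable_halfTan_rpow_smul f hβ0
          (d := -(π - 1 / ((n : ℝ) + 1))) (by rwa [abs_neg])).ae_hasDerivAt_integral
        filter_upwards [h2, h3] with x hx2 hx3 hx
        obtain ⟨hxl, hxr⟩ := abs_lt.1 hx
        rcases le_total 0 x with h | h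
        · exact hx2 (by rw [uIcc_of_le hnn]; exact ⟨h, hxr.le⟩) 0 left_mem_uIcc
        · exact hx3 (by rw [uIcc_of_ge (by linarith)]; exact ⟨hxl.le, h⟩) 0 left_mem_uIcc
      filter_upwards [ae_all_iff.2 h1] with x hx hxπ
      obtain ⟨n, hn⟩ := exists_nat_one_div_lt (sub_pos.2 hxπ)
      exact hx n (by linarith)
    have hg := ae_of_ae_circVol (solL2_ae_eq f hβ)
    have hk1 := ae_of_ae_circVol (Lp.coeFn_smul (β : ℂ) (f - solL2 f hβ))
    have hk2 := ae_of_ae_circVol (Lp.coeFn_sub f (solL2 f hβ))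
    filter_upwards [hW', hkint.ae_hasDerivAt_integral, hg, hk1, hk2] with x h1 h2 h3 h4 h5 hx hx0
    have hxm : x ∈ uIcc (-π) π := by
      rw [uIcc_of_le (by linarith)]
      exact ⟨(abs_lt.1 hx).1.le, (abs_lt.1 hx).2.le⟩
    have ht := halfTan_pos hx hx0
    have hs := sin_ne_zero_of_abs_lt hx hx0
    refine ((((hasDerivAt_halfTan_rpow hx hx0 (-β)).const_mul β).smul (h1 hx)).sub
      (h2 hxm 0 h0mem)).congr_deriv ?_
    rw [h4 hx, Pi.smul_apply, h5 hx, Pi.sub_apply, h3 hx, integral_solKernel_eq f β hx hx0]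
    change (β * halfTan x ^ (-β)) • (halfTan x ^ β • f x) +
      (β * (-β * halfTan x ^ (-β) / Real.sin x)) • W x -
      (β : ℂ) • (f x - ((β * halfTan x ^ (-β) / Real.sin x : ℝ) : ℂ) * W x) = 0
    have h6 : halfTan x ^ (-β) * halfTan x ^ β = 1 := by
      rw [← Real.rpow_add ht, neg_add_cancel, Real.rpow_zero]
    rw [smul_smul, mul_assoc, h6, mul_one, Complex.real_smul, Complex.real_smul, smul_eq_mul]
    push_cast
    ring
  · have h1 : Tendsto (fun t => v (t * d)) (nhdsWithin 0 (Ioi 0)) (nhds 0) := by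
      have h2 : Tendsto v (nhds 0) (nhds (v 0)) := continuousAt_zero_of_ac hvac
      have h3 : v 0 = 0 := by simp [hv]
      rw [h3] at h2
      exact h2.comp (tendsto_mul_nhdsGT_zero d)
    have h2 : Tendsto (fun t => u (t * d)) (nhdsWithin 0 (Ioi 0)) (nhds 0) := by
      have h3 : Tendsto (fun t : ℝ => √(β ^ 2 / (2 * β - 1) * |Real.sin (t * d)| * ‖f‖ ^ 2))
          (nhdsWithin 0 (Ioi 0)) (nhds 0) := by
        have h4 : Continuous fun x : ℝ => √(β ^ 2 / (2 * β - 1) * |Real.sin x| * ‖f‖ ^ 2) := by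
          fun_prop
        have h5 := (h4.tendsto 0).comp (tendsto_mul_nhdsGT_zero d)
        simpa [Function.comp_def] using h5
      refine squeeze_zero_norm' ?_ h3
      filter_upwards [Ioc_mem_nhdsGT (zero_lt_one (α := ℝ))] with t ht
      obtain ⟨h5, h6⟩ := abs_lt_pi_and_ne_zero_of_mem ht hd hd0 left_mem_uIcc
      rw [hu _ h5 h6]
      exact Real.le_sqrt_of_sq_le (norm_sin_mul_integral_solKernel_sq_le f hβ h5 h6)
    simpa using h2.sub h1

end FirstOrder

/-! ### The inverse of `L̃` -/

section Inverse

theorem abs_sin_rpow_mul_cancel {θ : ℝ} (h : |θ| < π) (h0 : θ ≠ 0) :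
    |Real.sin θ| ^ (-(1 / 4) : ℝ) * |Real.sin θ| ^ (1 / 4 : ℝ) = 1 := by
  rw [← Real.rpow_add (abs_pos.2 (sin_ne_zero_of_abs_lt h h0)), neg_add_cancel, Real.rpow_zero]

variable {β : ℝ} (hβ : 1 / 2 < β)

/-- `f ↦ ∫_{-π}^θ g`, where `g` solves the first order equation with right hand side `f`, as the
product of a Volterra operator and an operator with a square integrable kernel. -/
noncomputable def primitiveSolOp : L2Circ →L[ℂ] L2Circ :=
  volterraOp measurable_abs_sin_rpow lintegral_abs_sin_rpow_sq_lt_top ∘L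
    kernelOp (isHSKernel_sin_mul_solKernel hβ)

theorem exists_hasRankApprox_primitiveSolOp :
    ∃ C : ℝ, ∀ n : ℕ,
      HasRankApprox (primitiveSolOp hβ) (2 * n) (C * ((n : ℝ) + 1) ^ (-(3 / 2 : ℝ))) := by
  obtain ⟨C₁, h₁⟩ := exists_hasRankApprox_volterraOp (μ := circVol) measurable_abs_sin_rpow
    lintegral_abs_sin_rpow_sq_lt_top
  obtain ⟨C₂, h₂⟩ := exists_hasRankApprox_kernelOp (isHSKernel_sin_mul_solKernel hβ)
  refine ⟨C₁ * C₂, fun n => ((h₁ n).comp (h₂ n)).mono (by omega) (le_of_eq ?_)⟩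
  have h : ((n : ℝ) + 1) ^ (-(3 / 2 : ℝ)) = ((n : ℝ) + 1)⁻¹ * ((n : ℝ) + 1) ^ (-(1 / 2 : ℝ)) := by
    rw [← Real.rpow_neg_one, ← Real.rpow_add (by positivity)]
    norm_num
  rw [h]
  ring

/-- The weights |sin|^(1/4) and |sin|^(-1/4) cancel almost everywhere. -/
theorem primitiveSolOp_ae_eq (f : L2Circ) :
    primitiveSolOp hβ f =ᵐ[circVol] fun θ => ∫ s in (-π)..θ, solL2 f hβ s := by
  have h1 := kernelOp_ae_eq (isHSKernel_sin_mul_solKernel hβ) f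
  have h2 : ∀ᵐ s ∂circVol, ((|Real.sin s| ^ (-(1 / 4) : ℝ) : ℝ) : ℂ) *
      kernelOp (isHSKernel_sin_mul_solKernel hβ) f s = solL2 f hβ s := by
    filter_upwards [h1, solL2_ae_eq f hβ, ae_abs_lt_pi_and_ne_zero] with s hs1 hs2 hs3
    rw [hs1, hs2]
    simp only [Complex.ofReal_mul, mul_assoc]
    rw [integral_const_mul, ← mul_assoc, ← Complex.ofReal_mul,
      abs_sin_rpow_mul_cancel hs3.1 hs3.2, Complex.ofReal_one, one_mul]
  filter_upwards [kernelOp_ae_eq (isHSKernel_volterra (μ := circVol) measurable_abs_sin_rpow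
    lintegral_abs_sin_rpow_sq_lt_top) (kernelOp (isHSKernel_sin_mul_solKernel hβ) f),
    ae_restrict_mem measurableSet_Ioo] with θ hθ hmem
  refine Eq.trans hθ ?_
  have h3 : ∫ s, ((if s < θ then |Real.sin s| ^ (-(1 / 4) : ℝ) else 0 : ℝ) : ℂ) *
      kernelOp (isHSKernel_sin_mul_solKernel hβ) f s ∂circVol =
      ∫ s, (Iio θ).indicator (solL2 f hβ) s ∂circVol := by
    refine integral_congr_ae ?_
    filter_upwards [h2] with s hs
    by_cases hsθ : s < θ
    · have hm : s ∈ Iio θ := hsθ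
      rw [if_pos hsθ, indicator_of_mem hm, hs]
    · have hm : s ∉ Iio θ := hsθ
      rw [if_neg hsθ, indicator_of_notMem hm]
      simp
  rw [h3, integral_indicator measurableSet_Iio, Measure.restrict_restrict measurableSet_Iio,
    intervalIntegral.integral_of_le hmem.1.le, integral_Ioc_eq_integral_Ioo]
  congr 2
  ext s
  simp only [mem_inter_iff, mem_Iio, mem_Ioo]
  constructor
  · rintro ⟨h4, h5, -⟩
    exact ⟨h5, h4⟩
  · rintro ⟨h4, h5⟩
    exact ⟨h5, h4, h5.trans hmem.2⟩

/-- The constant function `1` in `L²(-π, π)`. -/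
noncomputable def oneL2 : L2Circ :=
  indicatorConstLp 2 (μ := circVol) MeasurableSet.univ (measure_ne_top _ _) (1 : ℂ)

theorem oneL2_ae_eq : oneL2 =ᵐ[circVol] fun _ => (1 : ℂ) := by
  filter_upwards [indicatorConstLp_coeFn (p := 2) (μ := circVol) (hs := MeasurableSet.univ)
    (hμs := measure_ne_top _ _) (c := (1 : ℂ))] with θ h
  rw [oneL2, h, indicator_univ]

theorem inner_oneL2 (f : L2Circ) : inner ℂ oneL2 f = ∫ θ, f θ ∂circVol := by
  rw [oneL2, L2.inner_indicatorConstLp_one, setIntegral_univ]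

theorem integral_oneL2 : ∫ θ, oneL2 θ ∂circVol = 2 * π := by
  have hpi := Real.pi_pos
  rw [integral_congr_ae oneL2_ae_eq, integral_const, measureReal_restrict_apply_univ,
    Real.volume_real_Ioo_of_le (by linarith), Complex.real_smul]
  push_cast
  ring

theorem mem_zeroMean_iff {f : L2Circ} : f ∈ zeroMean ↔ ∫ θ, f θ ∂circVol = 0 := Iff.rfl

/-- Subtraction of the mean value. -/
noncomputable def subMean : L2Circ →L[ℂ] zeroMean :=
  (ContinuousLinearMap.id ℂ L2Circ -
    ((2 * π : ℂ)⁻¹ • innerSL ℂ oneL2).smulRight oneL2).codRestrict zeroMean fun f => by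
      have hpi : (2 * π : ℂ) ≠ 0 := by
        simp [Real.pi_ne_zero]
      rw [mem_zeroMean_iff, ← inner_oneL2]
      simp only [sub_apply, ContinuousLinearMap.id_apply, ContinuousLinearMap.smulRight_apply,
        smul_apply, innerSL_apply_apply, inner_sub_right, inner_smul_right, smul_eq_mul,
        inner_oneL2 oneL2, integral_oneL2]
      field_simp
      ring

/-- Only a constant is removed, so the derivative does not change. -/
theorem subMean_ae_eq (f : L2Circ) :
    ∃ c : ℂ, ((subMean f : zeroMean) : L2Circ) =ᵐ[circVol] fun θ => f θ - c := by
  refine ⟨(2 * π : ℂ)⁻¹ * inner ℂ oneL2 f, ?_⟩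
  have h : ((subMean f : zeroMean) : L2Circ) =
      f - ((2 * π : ℂ)⁻¹ * inner ℂ oneL2 f) • oneL2 := rfl
  rw [h]
  filter_upwards [Lp.coeFn_sub f (((2 * π : ℂ)⁻¹ * inner ℂ oneL2 f) • oneL2),
    Lp.coeFn_smul ((2 * π : ℂ)⁻¹ * inner ℂ oneL2 f) oneL2, oneL2_ae_eq] with θ h1 h2 h3
  rw [h1, Pi.sub_apply, h2, Pi.smul_apply, h3, smul_eq_mul, mul_one]

/-- The inverse of `L̃`, for `β = 1 / ε`. -/
noncomputable def invLtilde : zeroMean →L[ℂ] zeroMean := (subMean ∘L primitiveSolOp hβ) ∘L zeroMean.subtypeL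

theorem memSchatten_invLtilde {p : ℝ} (hp : 2 / 3 < p) : MemSchatten p (invLtilde hβ) := by
  obtain ⟨C, hC⟩ := exists_hasRankApprox_primitiveSolOp hβ
  refine memSchatten_of_hasRankApprox (C := ‖subMean‖ * C * ‖zeroMean.subtypeL‖) (fun n => ?_) hp
  refine (((hC n).comp_left subMean).comp_right zeroMean.subtypeL).mono le_rfl (le_of_eq ?_)
  ring

theorem memLp_sin_mul (g : L2Circ) :
    MemLp (fun θ => (Real.sin θ : ℂ) * g θ) 2 circVol := by
  refine (Lp.memLp g).of_le ((Complex.measurable_ofReal.comp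
    Real.measurable_sin).aestronglyMeasurable.mul (Lp.aestronglyMeasurable g)) ?_
  refine Eventually.of_forall fun θ => ?_
  rw [norm_mul, Complex.norm_real]
  exact mul_le_of_le_one_left (norm_nonneg _) (Real.abs_sin_le_one θ)

/-- The values of the primitive at ±π differ by the integral of g. -/
theorem hasPeriodicL2Deriv_of_ae_eq {h g : L2Circ} {c : ℂ}
    (hh : h =ᵐ[circVol] fun θ => (∫ s in (-π)..θ, g s) - c) (hg : g ∈ zeroMean) :
    HasPeriodicL2Deriv h g := by
  have hpi := Real.pi_pos
  have hint : IntervalIntegrable g volume (-π) π :=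
    intervalIntegrable_L2Circ g (by simp [abs_of_pos hpi]) (abs_of_pos hpi).le
  refine ⟨fun θ => (∫ s in (-π)..θ, g s) - c,
    (hint.absolutelyContinuousOnInterval_integral left_mem_uIcc).sub
      (absolutelyContinuousOnInterval_const c _ _), hh, ?_, ?_⟩
  · filter_upwards [ae_restrict_of_ae hint.ae_hasDerivAt_integral,
      ae_restrict_mem measurableSet_Ioo] with θ h1 h2
    refine (h1 ?_ _ left_mem_uIcc).sub_const c
    rw [uIcc_of_le (by linarith)]
    exact Ioo_subset_Icc_self h2
  · have h1 : ∫ s in (-π)..π, g s = 0 := by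
      rw [intervalIntegral.integral_of_le (by linarith), integral_Ioc_eq_integral_Ioo]
      exact hg
    simp [h1]

theorem mem_graphL_invLtilde {ε : ℝ} (hε : ε ≠ 0) (hεβ : β = ε⁻¹) (f : zeroMean) :
    (((invLtilde hβ f : zeroMean) : L2Circ), (f : L2Circ)) ∈ graphL ε := by
  have hpi := Real.pi_pos
  set F : L2Circ := (f : L2Circ) with hF
  set g : L2Circ := solL2 F hβ with hg
  set k : L2Circ := (β : ℂ) • (F - g) with hk
  set w : L2Circ := (memLp_sin_mul g).toLp _ with hw
  have hwg : w =ᵐ[circVol] fun θ => (Real.sin θ : ℂ) * g θ :=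
    (memLp_sin_mul g).coeFn_toLp
  have hkint : IntervalIntegrable k volume (-π) π :=
    intervalIntegrable_L2Circ k (by simp [abs_of_pos hpi]) (abs_of_pos hpi).le
  have h0mem : (0 : ℝ) ∈ uIcc (-π) π := by
    rw [uIcc_of_le (by linarith)]
    exact ⟨by linarith, hpi.le⟩
  set v : ℝ → ℂ := fun θ => ∫ s in 0..θ, k s
  have hvac : AbsolutelyContinuousOnInterval v (-π) π :=
    hkint.absolutelyContinuousOnInterval_integral h0mem
  have hvg : ∀ᵐ θ ∂circVol, v θ = (Real.sin θ : ℂ) * g θ := by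
    filter_upwards [ae_abs_lt_pi_and_ne_zero, solL2_ae_eq F hβ] with θ h1 h2
    rw [hg, h2]
    exact integral_sub_solL2_eq F hβ h1.1 h1.2
  have hvd : ∀ᵐ θ ∂circVol, HasDerivAt v (k θ) θ := by
    filter_upwards [ae_restrict_of_ae hkint.ae_hasDerivAt_integral,
      ae_restrict_mem measurableSet_Ioo] with θ h1 h2
    refine h1 ?_ _ h0mem
    rw [uIcc_of_le (by linarith)]
    exact Ioo_subset_Icc_self h2
  have hβ0 : (β : ℂ) ≠ 0 := by
    rw [hεβ]
    exact_mod_cast inv_ne_zero hε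
  -- The mean of k is v(π) - v(-π) up to normalization. Both values vanish, since v / sin = g is
  -- integrable and sin vanishes there.
  have hkm : k ∈ zeroMean := by
    rw [mem_zeroMean_iff, integral_of_ac hvac (integrable_L2Circ k) hvd,
      eq_zero_of_sin_mul hvac (integrable_L2Circ g) hvg (c := π) ⟨by linarith, le_rfl⟩ Real.sin_pi,
      eq_zero_of_sin_mul hvac (integrable_L2Circ g) hvg (c := -π) ⟨le_rfl, by linarith⟩ (by simp),
      sub_self]
  -- Here the zero mean of f is used: g = f - β⁻¹ k.
  have hgm : g ∈ zeroMean := by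
    have h1 : F - g ∈ zeroMean := (zeroMean.smul_mem_iff hβ0).1 hkm
    have h2 := zeroMean.sub_mem f.2 h1
    rwa [sub_sub_cancel] at h2
  refine ⟨g, w, k, ?_, hwg, ⟨v, hvac, ?_, hvd⟩, ?_⟩
  · obtain ⟨c, hc⟩ := subMean_ae_eq (primitiveSolOp hβ F)
    refine hasPeriodicL2Deriv_of_ae_eq (c := c) ?_ hgm
    filter_upwards [hc, primitiveSolOp_ae_eq hβ F] with θ h1 h2
    exact h1.trans (by rw [h2])
  · filter_upwards [hwg, hvg] with θ h1 h2
    rw [h1, h2]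
  · change F = (ε : ℂ) • k + g
    have hεC : (ε : ℂ) ≠ 0 := by exact_mod_cast hε
    rw [hk, smul_smul, hεβ, Complex.ofReal_inv, mul_inv_cancel₀ hεC, one_smul, sub_add_cancel]

/-- `L` is injective on the functions with zero mean. -/
theorem eq_zero_of_mem_graphL {ε : ℝ} (hε : 0 < ε) {h : L2Circ} (hh : h ∈ zeroMean)
    (hg : (h, (0 : L2Circ)) ∈ graphL ε) : h = 0 := by
  have hpi := Real.pi_pos
  obtain ⟨g, w, k, ⟨u, hu1, hu2, hu3, -⟩, hwg, ⟨v, hv1, hv2, hv3⟩, hk⟩ := hg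
  have hk0 : ∀ᵐ θ ∂circVol, (ε : ℂ) * k θ + g θ = 0 := by
    filter_upwards [Lp.coeFn_add ((ε : ℂ) • k) g, Lp.coeFn_smul (ε : ℂ) k,
      Lp.coeFn_zero ℂ 2 circVol] with θ h1 h2 h3
    have hk' : (ε : ℂ) • k + g = 0 := hk.symm
    rw [hk', h3, Pi.add_apply, h2, Pi.smul_apply, smul_eq_mul] at h1
    exact h1.symm
  have hvg : ∀ᵐ θ ∂circVol, v θ = (Real.sin θ : ℂ) * g θ := by
    filter_upwards [hwg, hv2] with θ h1 h2
    rw [← h2, h1]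
  have hβ : 0 < ε⁻¹ := inv_pos.2 hε
  have hv0 : ∀ d, |d| < π → d ≠ 0 → v d = 0 := by
    intro d hd hd0
    -- With f = 0 the integrating factor makes t^(1/ε) v locally constant away from 0, and it tends
    -- to 0 at 0 because t does and v is continuous.
    have hD : halfTan d ^ ε⁻¹ • v d = 0 := by
      refine eq_zero_of_ae_hasDerivAt_zero (D := fun x => halfTan x ^ ε⁻¹ • v x) hd hd0
        (fun t ht => ?_) ?_ ?_
      · exact (absolutelyContinuousOnInterval_halfTan_rpow ht hd hd0 _).smul
          (hv1.mono (uIcc_mul_subset ht hd hd0))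
      · filter_upwards [ae_of_ae_circVol hk0, ae_of_ae_circVol hvg, ae_of_ae_circVol hv3]
          with x h1 h2 h3 hx hx0
        refine ((hasDerivAt_halfTan_rpow hx hx0 ε⁻¹).smul (h3 hx)).congr_deriv ?_
        have hs : (Real.sin x : ℂ) ≠ 0 := by exact_mod_cast sin_ne_zero_of_abs_lt hx hx0
        have hεC : (ε : ℂ) ≠ 0 := by exact_mod_cast hε.ne'
        have h4 : k x = -((ε : ℂ)⁻¹ * g x) := by
          have := h1 hx
          field_simp
          linear_combination this
        rw [h2 hx, h4, Complex.real_smul, Complex.real_smul]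
        simp only [Complex.ofReal_mul, Complex.ofReal_div, Complex.ofReal_inv]
        field_simp
        ring
      · have h1 : ContinuousAt (fun x => halfTan x ^ ε⁻¹ • v x) 0 :=
          ((continuousAt_halfTan (by simpa using hpi)).rpow_const (Or.inr hβ.le)).smul
            (continuousAt_zero_of_ac hv1)
        have h2 : halfTan 0 ^ ε⁻¹ • v 0 = 0 := by
          simp [halfTan, Real.zero_rpow hβ.ne']
        have h3 := h1.tendsto.comp (tendsto_mul_nhdsGT_zero d)
        rwa [h2] at h3
    exact (smul_eq_zero.1 hD).resolve_left (Real.rpow_pos_of_pos (halfTan_pos hd hd0) _).ne'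
  have hg0 : ∀ᵐ θ ∂circVol, g θ = 0 := by
    filter_upwards [hvg, ae_abs_lt_pi_and_ne_zero] with θ h1 h2
    rw [hv0 θ h2.1 h2.2] at h1
    exact (mul_eq_zero.1 h1.symm).resolve_left
      (by exact_mod_cast sin_ne_zero_of_abs_lt h2.1 h2.2)
  -- Now g = 0, so h is constant, and its zero mean makes the constant 0.
  obtain ⟨C, hC⟩ := hu1.const_of_ae_hasDerivAt_zero (by
    filter_upwards [ae_of_ae_circVol hg0, ae_of_ae_circVol hu3, Measure.ae_ne volume π,
      Measure.ae_ne volume (-π)] with x h1 h2 h3 h4 hx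
    rw [uIcc_of_le (by linarith)] at hx
    have hx' : |x| < π :=
      abs_lt.2 ⟨lt_of_le_of_ne hx.1 (Ne.symm h4), lt_of_le_of_ne hx.2 h3⟩
    have h5 := h2 hx'
    rwa [h1 hx'] at h5)
  have hhC : h =ᵐ[circVol] fun _ => C := by
    filter_upwards [hu2, ae_restrict_mem measurableSet_Ioo] with θ h1 h2
    rw [h1, hC θ (by rw [uIcc_of_le (by linarith)]; exact Ioo_subset_Icc_self h2)]
  have hC0 : C = 0 := by
    have h1 := mem_zeroMean_iff.1 hh
    rw [integral_congr_ae hhC, integral_const, measureReal_restrict_apply_univ,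
      Real.volume_real_Ioo_of_le (by linarith)] at h1
    exact (smul_eq_zero.1 h1).resolve_left (by linarith)
  refine Lp.ext ?_
  filter_upwards [hhC, Lp.coeFn_zero ℂ 2 circVol] with θ h1 h2
  rw [h1, h2, hC0]
  rfl

theorem mem_graph_opLtilde_iff {ε : ℝ} {x : zeroMean × zeroMean} :
    x ∈ (opLtilde ε).graph ↔ ((x.1 : L2Circ), (x.2 : L2Circ)) ∈ graphL ε := by
  rw [← opL_graph, LinearPMap.mem_graph_iff, LinearPMap.mem_graph_iff]
  constructor
  · rintro ⟨y, hy1, hy2⟩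
    exact ⟨⟨((y : zeroMean) : L2Circ), y.2⟩, congrArg Subtype.val hy1, congrArg Subtype.val hy2⟩
  · rintro ⟨⟨y, hy⟩, hy1, hy2⟩
    obtain rfl : y = x.1 := hy1
    exact ⟨⟨x.1, hy⟩, rfl, Subtype.ext hy2⟩

/-- A graph of the form {(T y, y)} carries injectivity, surjectivity and the formula for the inverse
all at once. -/
theorem isBoundedInverse_of_graph_iff {H : Type*} [NormedAddCommGroup H] [InnerProductSpace ℂ H]
    {A : H →ₗ.[ℂ] H} {T : H →L[ℂ] H} (h : ∀ x : H × H, x ∈ A.graph ↔ x.1 = T x.2) :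
    IsBoundedInverse A T := by
  have hker : A.toFun.ker = ⊥ := by
    rw [LinearMap.ker_eq_bot']
    intro y hy
    have h1 := (h _).1 (A.mem_graph y)
    have h2 : A y = 0 := hy
    rw [h2, map_zero] at h1
    exact Subtype.ext h1
  refine ⟨hker, LinearPMap.eq_of_eq_graph ?_⟩
  rw [LinearPMap.inverse_graph hker]
  ext ⟨a, b⟩
  rw [LinearPMap.mem_graph_iff]
  constructor
  · rintro ⟨⟨c, d⟩, hx, hx'⟩
    obtain ⟨rfl, rfl⟩ : d = a ∧ c = b := Prod.mk.inj hx'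
    exact ⟨⟨d, trivial⟩, rfl, ((h _).1 hx).symm⟩
  · rintro ⟨⟨y, _⟩, hy1, hy2⟩
    obtain rfl : y = a := hy1
    exact ⟨(b, y), (h _).2 hy2.symm, rfl⟩

/-- Existence puts (T f, f) in the graph; any other pair with the same f differs from it by some (h,
0), and injectivity gives h = 0. -/
theorem isBoundedInverse_invLtilde {ε : ℝ} (hε : 0 < ε) (hεβ : β = ε⁻¹) :
    IsBoundedInverse (opLtilde ε) (invLtilde hβ) := by
  refine isBoundedInverse_of_graph_iff fun x => ?_
  rw [mem_graph_opLtilde_iff]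
  have h1 := mem_graphL_invLtilde hβ hε.ne' hεβ x.2
  constructor
  · intro h2
    have h3 := (graphL ε).sub_mem h2 h1
    rw [Prod.mk_sub_mk, sub_self] at h3
    exact Subtype.ext (sub_eq_zero.1
      (eq_zero_of_mem_graphL hε (zeroMean.sub_mem x.1.2 (invLtilde hβ x.2).2) h3))
  · intro h2
    rw [h2]
    exact h1

end Inverse
-- The main theorem.
theorem mainTheorem6 (ε : ℝ) (hε₀ : 0 < ε) (hε₂ : ε < 2) :
    ∃ T : zeroMean →L[ℂ] zeroMean, IsBoundedInverse (opLtilde ε) T ∧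
      IsNuclear T ∧
      (ε ≤ 1 → ∀ p : ℝ, 2 / 3 < p → MemSchatten p T) ∧
      (1 < ε → ∀ p : ℝ, 2 * ε / (ε + 2) < p → MemSchatten p T) := by
  have hβ : 1 / 2 < ε⁻¹ := by
    rw [one_div]
    exact (inv_lt_inv₀ two_pos hε₀).2 hε₂
  refine ⟨invLtilde hβ, isBoundedInverse_invLtilde hβ hε₀ rfl,
    memSchatten_invLtilde hβ (by norm_num), fun _ p hp => memSchatten_invLtilde hβ hp,
    fun h1 p hp => memSchatten_invLtilde hβ (lt_of_le_of_lt ?_ hp)⟩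
  -- 2/3 ≤ 2ε/(ε+2) amounts to ε ≥ 1, so (ii) asks for less than has been proved.
  rw [div_le_div_iff₀ (by norm_num) (by linarith)]
  linarith
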